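/- Let $(W_t)_{t\ge 0}$ be a standard Brownian motion with $W_0=0$. Let $b:(0,\infty)\to\mathbb R$ be continuous such that $b(0):=\lim_{t\downarrow 0}b(t)$ exists in $[-\infty,0]$ and, if $b(0)=-\infty$, such that $b$ is monotone increasing on $(0,\epsilon]$ for some $\epsilon>0$. Let $$\tau=\inf\{t>0:\ W_t\le b(t)\}\qquad(\inf\emptyset=\infty)$$ and suppose that $b$ is a regular boundary, i.e. $P(\tau=0)=0$. Let $F(t)=P(\tau\le t)$ be the distribution function of $\tau$. For $p,z\in\mathbb R$ let $D_p(z)$ be the parabolic cylinder function, given for $p<0$ by $$D_p(z)=\frac{e^{-z^2/4}}{\Gamma(-p)}\int_0^\infty e^{-xz-x^2/2}\,x^{-p-1}\,dx$$ and for $p\ge 0$ by the recurrence $D_p(z)=zD_{p-1}(z)-(p-1)D_{p-2}(z)$. Then for every $t>0$ the integral below converges absolutely and $$\frac{e^{-\frac{b(t)^2}{4t}}\,D_p\!\left(-\frac{b(t)}{\sqrt t}\right)}{t^{(p+1)/2}}=\int_0^t e^{-\frac{(b(s)-b(t))^2}{4(t-s)}}\,\frac{D_p\!\left(\frac{b(s)-b(t)}{\sqrt{t-s}}\right)}{(t-s)^{(p+1)/2}}\,F(ds)$$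 in each of the following cases: (i) for all $p\le -1$ (with $b$ continuous on $(0,\infty)$, as assumed); (ii) for all $-1<p\le 0$, if $b$ is differentiable on $(0,\infty)$; (iii) for all $0<p<1$, if $b$ is continuously differentiable on $(0,\infty)$. -/

import Mathlib

open MeasureTheory ProbabilityTheory Set Filter Topology
open scoped NNReal ENNReal

/-- The parabolic cylinder function `D_p(z)` for real order `p` and real argument `z`.
For `p < 0` it is given by the integral representation
`D_p(z) = e^{-z²/4} / Γ(-p) * ∫₀^∞ e^{-xz - x²/2} x^{-p-1} dx`, and it is continued to `0 ≤ p` by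
the three-term recurrence `D_p(z) = z D_{p-1}(z) - (p-1) D_{p-2}(z)`. -/
noncomputable def parabolicCylinderD (p z : ℝ) : ℝ :=
  if p < 0 then
    Real.exp (-z ^ 2 / 4) / Real.Gamma (-p) *
      ∫ x in Ioi (0 : ℝ), Real.exp (-x * z - x ^ 2 / 2) * x ^ (-p - 1)
  else
    z * parabolicCylinderD (p - 1) z - (p - 1) * parabolicCylinderD (p - 2) z
termination_by ⌊p + 1⌋₊
decreasing_by
  all_goals
    have hp : 0 ≤ p := not_lt.mp ‹_›
    rw [Nat.floor_add_one hp, Nat.lt_succ_iff]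
    exact Nat.floor_le_floor (by linarith)

/-- The first-passage time `inf {t > 0 : W_t ≤ b(t)}` of the process `W` from above to the curve
`b`, with value `∞` if the set is empty. Only the values of `b` on `(0, ∞)` matter. -/
noncomputable def firstPassageTime {Ω : Type*} (W : ℝ≥0 → Ω → ℝ) (b : ℝ → ℝ) (ω : Ω) : ℝ≥0∞ :=
  ⨅ (t : ℝ≥0) (_ : 0 < t ∧ W t ω ≤ b t), (t : ℝ≥0∞)

/-- The measure `F(ds)` on the real line belonging to the (possibly defective) distribution
function `F(t) = P(τ ≤ t)` of the first-passage time `τ`: the law of `τ` without the mass at `∞`. -/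
noncomputable def firstPassageLaw {Ω : Type*} [MeasurableSpace Ω] (P : Measure Ω)
    (W : ℝ≥0 → Ω → ℝ) (b : ℝ → ℝ) : Measure ℝ :=
  ((P.map (firstPassageTime W b)).restrict {∞}ᶜ).map ENNReal.toReal

/-- `b : (0, ∞) → ℝ` is a regular boundary for `W`: it is continuous on `(0, ∞)`, has a value
`b(0) = lim_{t ↓ 0} b(t)` in `[-∞, 0]`, is increasing near `0` if `b(0) = -∞`, and the first-passage
time `τ` of `W` to `b` satisfies `P(τ = 0) = 0`. -/
structure IsRegularBoundary {Ω : Type*} [MeasurableSpace Ω] (P : Measure Ω)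
    (W : ℝ≥0 → Ω → ℝ) (b : ℝ → ℝ) : Prop where
  continuousOn : ContinuousOn b (Ioi 0)
  initialValue : ∃ b₀ : EReal, b₀ ≤ 0 ∧ Tendsto (fun s : ℝ => (b s : EReal)) (𝓝[>] 0) (𝓝 b₀) ∧
    (b₀ = ⊥ → ∃ ε : ℝ, 0 < ε ∧ MonotoneOn b (Ioc 0 ε))
  regular : P {ω | firstPassageTime W b ω = 0} = 0

/-- The integral equation of order `p` at time `t` with `y = b(t)`, for the measure `F`: the kernel
is `F`-integrable on `(0, t)`, and the equation holds. -/
def BoundaryVolterraEq (F : Measure ℝ) (b : ℝ → ℝ) (p t : ℝ) : Prop :=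
  IntegrableOn (fun s : ℝ => Real.exp (-(b s - b t) ^ 2 / (4 * (t - s))) *
      (parabolicCylinderD p ((b s - b t) / √(t - s)) / (t - s) ^ ((p + 1) / 2))) (Ioo 0 t) F ∧
    Real.exp (-b t ^ 2 / (4 * t)) * parabolicCylinderD p (-b t / √t) / t ^ ((p + 1) / 2) =
      ∫ s in Ioo 0 t, Real.exp (-(b s - b t) ^ 2 / (4 * (t - s))) *
        (parabolicCylinderD p ((b s - b t) / √(t - s)) / (t - s) ^ ((p + 1) / 2)) ∂F

/-!
The integral equations come from conditioning a function of the position at time `t` on the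
first-passage time `τ`. A path with `W t < y ≤ b t` has crossed the boundary strictly before `t`, and
at `τ` it sits on the boundary; so for a function `g` vanishing on `[y, ∞)`, the strong Markov
property at `τ` gives
`E g(W t) = ∫_{(0,t)} E g(b s + √(t - s) Z) F(ds)`, with `Z` standard normal
(`lintegral_eq_lintegral_restart`). The strong Markov property itself (`integral_firstPassageTime_lt_eq`)
is obtained from the Markov property at the points of a grid of mesh `t / N` just after `τ`, by letting
`N → ∞`.

* For `p < 0`, take `g w = (y - w)₊^{-p-1}`. Its Gaussian mean is, up to a constant factor, the
  parabolic cylinder kernel of order `p` (`lintegral_truncated_power`), so the choice `y = b t` gives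
  the equation (`levelVolterraEq_of_neg`). As `g ≥ 0`, integrability comes from the finiteness of the
  left-hand side.

* For `0 ≤ p < 1`, the kernel of order `p` is the derivative in the level `y` of the kernel of order
  `p - 1`. At levels `y < b t` the kernels stay bounded as `s ↑ t`, and the equation of order `p - 1`
  may be differentiated under the integral (`levelVolterraEq_of_lt_boundary`). To let `y ↑ b t`
  (`levelVolterraEq_boundary`), note that `b s - b t = o(√(t - s))` when `b` is differentiable at `t`,
  and that `D_p` is positive near `0` and on the positive half-line: for `s` near `t` all kernels are
  nonnegative. Fatou's lemma bounds the integral of the kernel at level `b t`, which is comparable to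
  `(t - s)^{-(p+1)/2}` there; hence this singularity is `F`-integrable, and dominated convergence
  applies.
-/

open scoped BoundedContinuousFunction

/-! ### Continuous paths and the first-passage time -/

/-- A Brownian motion agrees, outside a null set and for all times at once, with a process that is
measurable at each time and has continuous paths everywhere. -/
lemma exists_measurable_continuous_version {Ω : Type*} [MeasurableSpace Ω] {P : Measure Ω}
    {W : ℝ≥0 → Ω → ℝ} (hW : IsBrownianReal W P) :
    ∃ B : ℝ≥0 → Ω → ℝ, (∀ t, Measurable (B t)) ∧ (∀ ω, Continuous (B · ω)) ∧
      ∀ᵐ ω ∂P, ∀ t, W t ω = B t ω := by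
  classical
  let d := TopologicalSpace.denseSeq ℝ≥0
  let f : ℕ → Ω → ℝ := fun n => (hW.aemeasurable (d n)).mk _
  have hae : ∀ᵐ ω ∂P, Continuous (W · ω) ∧ ∀ n, W (d n) ω = f n ω :=
    hW.cont.and (ae_all_iff.2 fun n => (hW.aemeasurable (d n)).ae_eq_mk)
  obtain ⟨G, hGsub, hGmeas, hG⟩ :
      ∃ G, G ⊆ {ω | Continuous (W · ω) ∧ ∀ n, W (d n) ω = f n ω} ∧ MeasurableSet G ∧
        ∀ᵐ ω ∂P, ω ∈ G := by
    refine ⟨(toMeasurable P {ω | ¬ (Continuous (W · ω) ∧ ∀ n, W (d n) ω = f n ω)})ᶜ, ?_,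
      (measurableSet_toMeasurable _ _).compl, ?_⟩
    · intro ω hω
      by_contra h
      exact hω (subset_toMeasurable _ _ h)
    · have : P (toMeasurable P {ω | ¬ (Continuous (W · ω) ∧ ∀ n, W (d n) ω = f n ω)}) = 0 := by
        rw [measure_toMeasurable]; exact hae
      exact measure_eq_zero_iff_ae_notMem.1 this
  refine ⟨fun t => G.indicator (W t), ?_, ?_, ?_⟩
  · have hd : ∀ n, Measurable (G.indicator (W (d n))) := by
      intro n
      have : G.indicator (W (d n)) = G.indicator (f n) := by
        ext ω
        by_cases h : ω ∈ G
        · simp [h, (hGsub h).2 n]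
        · simp [h]
      rw [this]
      exact (hW.aemeasurable (d n)).measurable_mk.indicator hGmeas
    intro t
    obtain ⟨x, hx, hxt⟩ := mem_closure_iff_seq_limit.1
      ((TopologicalSpace.denseRange_denseSeq ℝ≥0) t)
    refine measurable_of_tendsto_metrizable (f := fun n => G.indicator (W (x n))) ?_ ?_
    · intro n
      obtain ⟨k, hk⟩ := hx n
      rw [← hk]
      exact hd k
    · rw [tendsto_pi_nhds]
      intro ω
      by_cases h : ω ∈ G
      · simpa [h, Function.comp_def] using ((hGsub h).1.tendsto t).comp hxt
      · simp [h]
  · intro ω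
    by_cases h : ω ∈ G
    · simpa [h] using (hGsub h).1
    · simpa [h] using continuous_const
  · filter_upwards [hG] with ω hω t
    simp [hω]

lemma firstPassageTime_lt_iff {Ω : Type*} {W : ℝ≥0 → Ω → ℝ} {b : ℝ → ℝ} {ω : Ω} {c : ℝ≥0∞} :
    firstPassageTime W b ω < c ↔ ∃ s : ℝ≥0, 0 < s ∧ (s : ℝ≥0∞) < c ∧ W s ω ≤ b s := by
  simp only [firstPassageTime, iInf_lt_iff, exists_prop]
  exact exists_congr fun s => by tauto

/-- A continuous path meets the closed region below the boundary during an open time set `U` iff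
on some compact interval in `U` it comes arbitrarily close to that region at times of a dense
sequence. -/
lemma exists_le_boundary_iff {f : ℝ≥0 → ℝ} (hf : Continuous f) {b : ℝ → ℝ}
    (hb : ContinuousOn b (Ioi 0)) {U : Set ℝ≥0} (hU : IsOpen U) (hU0 : U ⊆ Ioi 0)
    {d : ℕ → ℝ≥0} (hd : DenseRange d) :
    (∃ s ∈ U, f s ≤ b s) ↔
      ∃ u v : ℕ, Icc (d u) (d v) ⊆ U ∧
        ∀ m : ℕ, ∃ k : ℕ, d k ∈ Icc (d u) (d v) ∧ f (d k) < b (d k) + 1 / ((m : ℝ) + 1) := by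
  have hbU : ContinuousOn (fun s : ℝ≥0 => b s) U :=
    hb.comp NNReal.continuous_coe.continuousOn fun s hs => NNReal.coe_pos.2 (hU0 hs)
  constructor
  · rintro ⟨s, hs, hfs⟩
    have hs0 : 0 < s := hU0 hs
    obtain ⟨l, w, hlw, hsub⟩ := (mem_nhds_iff_exists_Ioo_subset' ⟨0, hs0⟩
      ⟨s + 1, lt_add_one s⟩).1 (hU.mem_nhds hs)
    obtain ⟨_, ⟨u, rfl⟩, hu⟩ := hd.exists_between hlw.1
    obtain ⟨_, ⟨v, rfl⟩, hv⟩ := hd.exists_between hlw.2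
    refine ⟨u, v, fun x hx => hsub ⟨hu.1.trans_le hx.1, hx.2.trans_lt hv.2⟩, fun m => ?_⟩
    have hm : (0 : ℝ) < 1 / ((m : ℝ) + 1) := by positivity
    have hcont : ContinuousAt (fun s : ℝ≥0 => b s + 1 / ((m : ℝ) + 1) - f s) s :=
      ((hbU.continuousAt (hU.mem_nhds hs)).add continuousAt_const).sub hf.continuousAt
    have hev : ∀ᶠ x : ℝ≥0 in 𝓝 s, 0 < b x + 1 / ((m : ℝ) + 1) - f x :=
      hcont.eventually_const_lt (by linarith)
    obtain ⟨O, hO, hOo, hsO⟩ := mem_nhds_iff.1 (hev.and (Ioo_mem_nhds hu.2 hv.1))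
    obtain ⟨k, hk⟩ := hd.exists_mem_open hOo ⟨s, hsO⟩
    obtain ⟨h1, h2⟩ := hO hk
    exact ⟨k, Ioo_subset_Icc_self h2, by linarith⟩
  · rintro ⟨u, v, hsub, h⟩
    choose k hk hlt using h
    obtain ⟨s, hs, φ, hφ, hlim⟩ := isCompact_Icc.tendsto_subseq hk
    refine ⟨s, hsub hs, ?_⟩
    have h1 : Tendsto (fun n => f (d (k (φ n)))) atTop (𝓝 (f s)) := (hf.tendsto s).comp hlim
    have h2 : Tendsto (fun n => b (d (k (φ n))) + 1 / ((φ n : ℝ) + 1)) atTop (𝓝 (b s + 0)) :=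
      ((hbU.continuousAt (hU.mem_nhds (hsub hs))).tendsto.comp hlim).add
        (tendsto_one_div_add_atTop_nhds_zero_nat.comp hφ.tendsto_atTop)
    rw [add_zero] at h2
    exact le_of_tendsto_of_tendsto' h1 h2 fun n => (hlt (φ n)).le

/-- For a process with continuous paths, `{τ < c}` belongs to any σ-algebra for which the process is
measurable at all times before `c`. -/
lemma measurableSet_firstPassageTime_lt {Ω : Type*} {m : MeasurableSpace Ω} {B : ℝ≥0 → Ω → ℝ}
    (hBc : ∀ ω, Continuous (B · ω)) {b : ℝ → ℝ} (hb : ContinuousOn b (Ioi 0)) {c : ℝ≥0∞}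
    (hBm : ∀ s : ℝ≥0, (s : ℝ≥0∞) < c → Measurable (B s)) :
    MeasurableSet {ω | firstPassageTime B b ω < c} := by
  let d := TopologicalSpace.denseSeq ℝ≥0
  let U : Set ℝ≥0 := {s | 0 < s ∧ (s : ℝ≥0∞) < c}
  have hU : IsOpen U := (isOpen_lt continuous_const continuous_id).inter
    (isOpen_lt ENNReal.continuous_coe continuous_const)
  have heq : {ω | firstPassageTime B b ω < c} =
      ⋃ (u : ℕ) (v : ℕ) (_ : Icc (d u) (d v) ⊆ U), ⋂ m : ℕ, ⋃ (k : ℕ)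
        (_ : d k ∈ Icc (d u) (d v)), {ω | B (d k) ω < b (d k) + 1 / ((m : ℝ) + 1)} := by
    ext ω
    simp only [mem_ofPred_eq, firstPassageTime_lt_iff, mem_iUnion, mem_iInter, exists_prop]
    rw [← exists_le_boundary_iff (hBc ω) hb hU (fun s hs => hs.1)
      (TopologicalSpace.denseRange_denseSeq ℝ≥0)]
    exact exists_congr fun s => by simp only [U, mem_ofPred_eq]; tauto
  rw [heq]
  refine MeasurableSet.iUnion fun u => MeasurableSet.iUnion fun v => MeasurableSet.iUnion fun huv =>
    MeasurableSet.iInter fun m => MeasurableSet.iUnion fun k => MeasurableSet.iUnion fun hk => ?_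
  exact measurableSet_lt (hBm _ (huv hk).2) measurable_const

lemma measurable_firstPassageTime {Ω : Type*} [MeasurableSpace Ω] {B : ℝ≥0 → Ω → ℝ}
    (hBm : ∀ s, Measurable (B s)) (hBc : ∀ ω, Continuous (B · ω)) {b : ℝ → ℝ}
    (hb : ContinuousOn b (Ioi 0)) : Measurable (firstPassageTime B b) :=
  measurable_of_Iio fun _ => measurableSet_firstPassageTime_lt hBc hb fun s _ => hBm s

/-- At a positive finite first-passage time, a continuous path sits on the boundary. -/
lemma eq_boundary_at_firstPassageTime {Ω : Type*} {B : ℝ≥0 → Ω → ℝ} {b : ℝ → ℝ} {ω : Ω}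
    (hBc : Continuous (B · ω)) (hb : ContinuousOn b (Ioi 0)) {s : ℝ≥0} (hs : 0 < s)
    (hτ : firstPassageTime B b ω = s) : B s ω = b s := by
  have hcont : ContinuousAt (fun x : ℝ≥0 => b x - B x ω) s := by
    refine ContinuousAt.sub (f := fun x : ℝ≥0 => b x) ?_ hBc.continuousAt
    exact (hb.continuousAt (Ioi_mem_nhds (NNReal.coe_pos.2 hs))).comp
      NNReal.continuous_coe.continuousAt
  apply le_antisymm
  · by_contra! h
    -- if the path were above the boundary at `s`, the passage would come strictly after `s`
    have hev : ∀ᶠ x : ℝ≥0 in 𝓝 s, b x - B x ω < 0 := hcont.eventually_lt_const (by linarith)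
    obtain ⟨l, w, hlw, hsub⟩ := (mem_nhds_iff_exists_Ioo_subset' ⟨0, hs⟩
      ⟨s + 1, lt_add_one s⟩).1 hev
    have : firstPassageTime B b ω < (w : ℝ≥0∞) := by
      rw [hτ]; exact_mod_cast hlw.2
    obtain ⟨x, hx0, hxw, hxle⟩ := firstPassageTime_lt_iff.1 this
    have hsx : s ≤ x := by
      by_contra! hxs
      have : firstPassageTime B b ω < (s : ℝ≥0∞) :=
        firstPassageTime_lt_iff.2 ⟨x, hx0, by exact_mod_cast hxs, hxle⟩
      exact absurd hτ this.ne
    have : b x - B x ω < 0 := hsub ⟨hlw.1.trans_le hsx, by exact_mod_cast hxw⟩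
    linarith
  · by_contra! h
    -- if it were below the boundary at `s`, it would have been below at earlier times
    have hev : ∀ᶠ x : ℝ≥0 in 𝓝 s, 0 < b x - B x ω := hcont.eventually_const_lt (by linarith)
    obtain ⟨l, w, hlw, hsub⟩ := (mem_nhds_iff_exists_Ioo_subset' ⟨0, hs⟩
      ⟨s + 1, lt_add_one s⟩).1 hev
    obtain ⟨x, hlx, hxs⟩ := exists_between hlw.1
    have hx : 0 < b x - B x ω := hsub ⟨hlx, hxs.trans hlw.2⟩
    have : firstPassageTime B b ω < (s : ℝ≥0∞) :=
      firstPassageTime_lt_iff.2 ⟨x, pos_of_gt hlx, by exact_mod_cast hxs, by linarith⟩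
    exact absurd hτ this.ne

/-- A continuous path strictly below the boundary at time `t` has passed strictly before `t`. -/
lemma firstPassageTime_lt_of_lt_boundary {Ω : Type*} {B : ℝ≥0 → Ω → ℝ} {b : ℝ → ℝ} {ω : Ω}
    (hBc : Continuous (B · ω)) (hb : ContinuousOn b (Ioi 0)) {t : ℝ≥0} (ht : 0 < t)
    (h : B t ω < b t) : firstPassageTime B b ω < t := by
  have hle : firstPassageTime B b ω ≤ t := iInf₂_le t ⟨ht, h.le⟩
  exact lt_of_le_of_ne hle fun heq => h.ne (eq_boundary_at_firstPassageTime hBc hb ht heq)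

/-! ### The strong Markov property at the first-passage time -/

/-- The heat semigroup acting on a function `g`: the mean of `g` at a Gaussian variable with mean
`x` and variance `v`. -/
noncomputable def heatMean (g : ℝ → ℝ) (v x : ℝ) : ℝ := ∫ z, g (x + √v * z) ∂(gaussianReal 0 1)

lemma continuous_heatMean (g : ℝ →ᵇ ℝ) : Continuous (fun q : ℝ × ℝ => heatMean g q.1 q.2) := by
  refine continuous_of_dominated (bound := fun _ => ‖g‖) ?_ ?_ (integrable_const _) ?_
  · intro q
    exact (g.continuous.comp (by fun_prop)).aestronglyMeasurable
  · intro q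
    exact ae_of_all _ fun z => g.norm_coe_le_norm _
  · refine ae_of_all _ fun z => g.continuous.comp ?_
    fun_prop

lemma abs_heatMean_le (g : ℝ →ᵇ ℝ) (v x : ℝ) : |heatMean g v x| ≤ ‖g‖ := by
  have := norm_integral_le_of_norm_le_const (μ := gaussianReal 0 1)
    (ae_of_all _ fun z => g.norm_coe_le_norm (x + √v * z))
  simpa [heatMean] using this

lemma gaussianReal_eq_map_sqrt_mul (v : ℝ≥0) :
    gaussianReal 0 v = (gaussianReal 0 1).map (√(v : ℝ) * ·) := by
  rw [gaussianReal_map_const_mul]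
  simp only [mul_zero, mul_one]
  congr 1
  ext
  simp

section Markov

variable {Ω : Type*} [MeasurableSpace Ω] {P : Measure Ω} [IsProbabilityMeasure P]
  {B : ℝ≥0 → Ω → ℝ}

/-- The Markov property at a fixed time `r`, in integrated form. -/
lemma setIntegral_comp_eq_setIntegral_heatMean (hB : IsPreBrownianReal B P)
    (hBm : ∀ t, Measurable (B t)) (g : ℝ →ᵇ ℝ) {r t : ℝ≥0} (hrt : r ≤ t) {A : Set Ω}
    (hA : MeasurableSet[MeasurableSpace.comap (fun ω (s : Iic r) => B s ω) inferInstance] A) :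
    ∫ ω in A, g (B t ω) ∂P = ∫ ω in A, heatMean g (t - r) (B r ω) ∂P := by
  obtain ⟨A', hA', rfl⟩ := hA
  have hφ : Measurable fun x : ℝ≥0 → ℝ => x (t - r) := measurable_pi_apply _
  have hind := (hB.indepFun_shift r).comp hφ measurable_id
  set X : Ω → (Iic r → ℝ) := fun ω s => B s ω with hXdef
  have hX : Measurable X := measurable_pi_lambda _ fun s => hBm s
  set Y : Ω → ℝ := fun ω => B t ω - B r ω with hYdef
  have hY : Measurable Y := (hBm t).sub (hBm r)
  have hXY : IndepFun Y X P := by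
    have h1 : (fun x : ℝ≥0 → ℝ => x (t - r)) ∘ (fun ω t ↦ B (r + t) ω - B r ω) = Y := by
      ext ω; simp [Y, add_tsub_cancel_of_le hrt]
    rw [h1] at hind
    exact hind
  have hlaw : P.map Y = (gaussianReal 0 1).map (√((t : ℝ) - r) * ·) := by
    have h1 := (hB.hasLaw_sub t r).map_eq
    have h2 : nndist (t : ℝ) r = t - r := by
      ext
      rw [coe_nndist, NNReal.coe_sub hrt, Real.dist_eq, abs_of_nonneg]
      exact sub_nonneg.2 (NNReal.coe_le_coe.2 hrt)
    have h3 : (B t - B r) = Y := rfl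
    rw [h3] at h1
    rw [h1]
    erw [h2]
    rw [gaussianReal_eq_map_sqrt_mul, NNReal.coe_sub hrt]
  have hprod := (indepFun_iff_map_prod_eq_prod_map_map hX.aemeasurable hY.aemeasurable).1 hXY.symm
  set r' : Iic r := ⟨r, le_refl r⟩
  have hev : Measurable fun x : Iic r → ℝ => x r' := measurable_pi_apply r'
  have : IsProbabilityMeasure (P.map X) := Measure.isProbabilityMeasure_map hX.aemeasurable
  have : IsProbabilityMeasure (P.map Y) := Measure.isProbabilityMeasure_map hY.aemeasurable
  set H : (Iic r → ℝ) × ℝ → ℝ := fun q => (A'.indicator 1 q.1 : ℝ) * g (q.1 r' + q.2) with hH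
  have hHm : Measurable H :=
    ((measurable_one.indicator hA').comp measurable_fst).mul
      (g.continuous.measurable.comp ((hev.comp measurable_fst).add measurable_snd))
  have hHb : ∀ q, ‖H q‖ ≤ ‖g‖ := by
    intro q
    by_cases h : q.1 ∈ A'
    · simpa [H, h] using g.norm_coe_le_norm (q.1 r' + q.2)
    · simp [H, h]
  have hA : MeasurableSet (X ⁻¹' A') := hX hA'
  calc ∫ ω in X ⁻¹' A', g (B t ω) ∂P = ∫ ω, H (X ω, Y ω) ∂P := by
        rw [← integral_indicator hA]
        congr 1 with ω
        by_cases h : X ω ∈ A'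
        · have h' : ω ∈ X ⁻¹' A' := h
          simp only [H, h, h', indicator_of_mem, Pi.one_apply, one_mul]
          congr 1
          simp [X, Y, r']
        · have h' : ω ∉ X ⁻¹' A' := h
          simp only [H, h, h', indicator_of_notMem, not_false_iff, zero_mul]
    _ = ∫ q, H q ∂((P.map X).prod (P.map Y)) := by
        rw [← hprod, integral_map (hX.prodMk hY).aemeasurable hHm.aestronglyMeasurable]
    _ = ∫ x, ∫ y, H (x, y) ∂(P.map Y) ∂(P.map X) :=
        integral_prod _ (Integrable.of_bound hHm.aestronglyMeasurable _ (ae_of_all _ hHb))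
    _ = ∫ x, A'.indicator 1 x * heatMean g (t - r) (x r') ∂(P.map X) := by
        congr 1 with x
        simp only [H]
        rw [integral_const_mul, hlaw, integral_map (by fun_prop)]
        · rfl
        · exact (g.continuous.comp (by fun_prop)).aestronglyMeasurable
    _ = ∫ ω, A'.indicator 1 (X ω) * heatMean g (t - r) (B r ω) ∂P := by
        rw [integral_map hX.aemeasurable]
        exact ((measurable_one.indicator hA').mul ((continuous_heatMean g).measurable.comp
          (measurable_const.prodMk hev))).aestronglyMeasurable
    _ = ∫ ω in X ⁻¹' A', heatMean g (t - r) (B r ω) ∂P := by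
        rw [← integral_indicator hA]
        congr 1 with ω
        by_cases h : X ω ∈ A'
        · have h' : ω ∈ X ⁻¹' A' := h
          simp only [h, h', indicator_of_mem, Pi.one_apply, one_mul]
        · have h' : ω ∉ X ⁻¹' A' := h
          simp only [h, h', indicator_of_notMem, not_false_iff, zero_mul]


/-- For a point `x` of `[0, t)`, only one cell of the grid `t j / N` contains it, the one with index
`⌊N x / t⌋`. -/
lemma grid_cell_iff {t x : ℝ≥0} (ht : 0 < t) {N : ℕ} (hN : 0 < N) (j : ℕ) :
    (t * (j : ℝ≥0) / N ≤ x ∧ x < t * ((j + 1 : ℕ) : ℝ≥0) / N) ↔ j = ⌊(N : ℝ≥0) * x / t⌋₊ := by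
  have hN' : (0 : ℝ≥0) < N := by exact_mod_cast hN
  rw [eq_comm, Nat.floor_eq_iff (by positivity), div_le_iff₀ hN', lt_div_iff₀ hN', le_div_iff₀ ht,
    div_lt_iff₀ ht]
  push_cast
  rw [mul_comm t, mul_comm x, mul_comm t]

/-- **Strong Markov property** at the first-passage time `τ`, in integrated form: given `τ < t`, the
value at time `t` is Gaussian with mean `b τ` and variance `t - τ`. -/
theorem integral_firstPassageTime_lt_eq (hB : IsPreBrownianReal B P)
    (hBm : ∀ t, Measurable (B t)) (hBc : ∀ ω, Continuous (B · ω)) {b : ℝ → ℝ}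
    (hb : ContinuousOn b (Ioi 0)) (hreg : P {ω | firstPassageTime B b ω = 0} = 0)
    (g : ℝ →ᵇ ℝ) {t : ℝ≥0} (ht : 0 < t) :
    ∫ ω in {ω | firstPassageTime B b ω < t}, g (B t ω) ∂P =
      ∫ ω in {ω | firstPassageTime B b ω < t},
        heatMean g (t - (firstPassageTime B b ω).toReal) (b (firstPassageTime B b ω).toReal) ∂P := by
  set τ := firstPassageTime B b with hτdef
  have hτm : Measurable τ := measurable_firstPassageTime hBm hBc hb
  have hT : MeasurableSet {ω | τ ω < t} := measurableSet_lt hτm measurable_const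
  let r : ℕ → ℕ → ℝ≥0 := fun n j => t * (j : ℝ≥0) / ((n + 1 : ℕ) : ℝ≥0)
  let A : ℕ → ℕ → Set Ω := fun n j => {ω | τ ω < r n (j + 1)} \ {ω | τ ω < r n j}
  have hrt : ∀ n j, j ∈ Finset.range (n + 1) → r n (j + 1) ≤ t := by
    intro n j hj
    have hj' : ((j + 1 : ℕ) : ℝ≥0) ≤ ((n + 1 : ℕ) : ℝ≥0) := by
      exact_mod_cast Finset.mem_range.1 hj
    have hn : (0 : ℝ≥0) < ((n + 1 : ℕ) : ℝ≥0) := by positivity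
    rw [div_le_iff₀ hn]
    gcongr
  have hmono : ∀ n j, r n j ≤ r n (j + 1) := by
    intro n j
    simp only [r]
    gcongr
    simp
  have hAm : ∀ n j, MeasurableSet (A n j) := fun n j =>
    (measurableSet_lt hτm measurable_const).diff (measurableSet_lt hτm measurable_const)
  have hAcomap : ∀ n j, MeasurableSet[MeasurableSpace.comap
      (fun ω (s : Iic (r n (j + 1))) => B s ω) inferInstance] (A n j) := by
    intro n j
    have hmeas : ∀ s : ℝ≥0, s ≤ r n (j + 1) → Measurable[MeasurableSpace.comap
      (fun ω (s : Iic (r n (j + 1))) => B s ω) inferInstance] (B s) := by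
      intro s hs
      exact (measurable_pi_apply (⟨s, hs⟩ : Iic (r n (j + 1)))).comp
        (comap_measurable (fun ω (s : Iic (r n (j + 1))) => B s ω))
    refine MeasurableSet.diff ?_ ?_
    · exact measurableSet_firstPassageTime_lt hBc hb fun s hs =>
        hmeas s (by exact_mod_cast hs.le)
    · exact measurableSet_firstPassageTime_lt hBc hb fun s hs =>
        hmeas s ((by exact_mod_cast hs.le : s ≤ r n j).trans (hmono n j))
  -- on `{τ < t}` a sum over the cells reduces to the term of the cell containing `τ`
  have hsum : ∀ n (f : ℕ → Ω → ℝ) ω, τ ω < t →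
      ∑ j ∈ Finset.range (n + 1), (A n j).indicator (f j) ω =
        f ⌊((n + 1 : ℕ) : ℝ≥0) * (τ ω).toNNReal / t⌋₊ ω := by
    intro n f ω hω
    set x := (τ ω).toNNReal with hx
    have hxτ : τ ω = x := (ENNReal.coe_toNNReal hω.ne_top).symm
    have hxt : x < t := by rw [hxτ] at hω; exact_mod_cast hω
    have hmem : ∀ j, ω ∈ A n j ↔ j = ⌊((n + 1 : ℕ) : ℝ≥0) * x / t⌋₊ := by
      intro j
      rw [← grid_cell_iff ht n.succ_pos]
      simp only [A, Set.mem_sdiff, mem_ofPred_eq, hxτ, ENNReal.coe_lt_coe, not_lt, r]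
      exact and_comm
    rw [Finset.sum_eq_single ⌊((n + 1 : ℕ) : ℝ≥0) * x / t⌋₊]
    · rw [indicator_of_mem ((hmem _).2 rfl)]
    · intro j _ hj
      rw [indicator_of_notMem fun h => hj ((hmem _).1 h)]
    · intro hnot
      exfalso
      apply hnot
      rw [Finset.mem_range, Nat.floor_lt (by positivity), div_lt_iff₀ ht]
      have hn : (0 : ℝ≥0) < ((n + 1 : ℕ) : ℝ≥0) := by positivity
      exact mul_lt_mul_of_pos_left hxt hn
  have hsum0 : ∀ n (f : ℕ → Ω → ℝ) ω, ¬ τ ω < t →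
      ∑ j ∈ Finset.range (n + 1), (A n j).indicator (f j) ω = 0 := by
    intro n f ω hω
    refine Finset.sum_eq_zero fun j hj => indicator_of_notMem (fun h => hω ?_) _
    exact h.1.trans_le (by exact_mod_cast hrt n j hj)
  let H : ℕ → Ω → ℝ := fun n ω => ∑ j ∈ Finset.range (n + 1),
    (A n j).indicator (fun ω => heatMean g (t - r n (j + 1)) (B (r n (j + 1)) ω)) ω
  have hterm : ∀ n j, Measurable fun ω => heatMean g (t - r n (j + 1)) (B (r n (j + 1)) ω) :=
    fun n j => (continuous_heatMean g).measurable.comp (measurable_const.prodMk (hBm _))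
  have hgm : Measurable fun ω => g (B t ω) := g.continuous.measurable.comp (hBm t)
  have hHeq : ∀ n, ∫ ω in {ω | τ ω < t}, g (B t ω) ∂P = ∫ ω, H n ω ∂P := by
    intro n
    have h1 : ({ω | τ ω < t}).indicator (fun ω => g (B t ω)) =
        fun ω => ∑ j ∈ Finset.range (n + 1), (A n j).indicator (fun ω => g (B t ω)) ω := by
      ext ω
      by_cases h : τ ω < t
      · rw [hsum n _ ω h, indicator_of_mem (show ω ∈ {ω | τ ω < t} from h)]
      · rw [hsum0 n _ ω h, indicator_of_notMem (show ω ∉ {ω | τ ω < t} from h)]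
    rw [← integral_indicator hT, h1, integral_finsetSum, integral_finsetSum]
    · refine Finset.sum_congr rfl fun j hj => ?_
      rw [integral_indicator (hAm n j), integral_indicator (hAm n j)]
      exact setIntegral_comp_eq_setIntegral_heatMean hB hBm g (hrt n j hj) (hAcomap n j)
    · intro j _
      exact (Integrable.of_bound (hterm n j).aestronglyMeasurable ‖g‖
        (ae_of_all _ fun ω => abs_heatMean_le g _ _)).indicator (hAm n j)
    · intro j _
      exact (Integrable.of_bound hgm.aestronglyMeasurable ‖g‖
        (ae_of_all _ fun ω => g.norm_coe_le_norm _)).indicator (hAm n j)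
  have hlim : Tendsto (fun n => ∫ ω, H n ω ∂P) atTop (𝓝 (∫ ω, ({ω | τ ω < t}).indicator
      (fun ω => heatMean g (t - (τ ω).toReal) (b (τ ω).toReal)) ω ∂P)) := by
    refine tendsto_integral_of_dominated_convergence (fun _ => ‖g‖) ?_ (integrable_const _) ?_ ?_
    · intro n
      refine Measurable.aestronglyMeasurable ?_
      exact Finset.measurable_fun_sum _ fun j _ => (hterm n j).indicator (hAm n j)
    · intro n
      refine ae_of_all _ fun ω => ?_
      by_cases h : τ ω < t
      · simp only [H]
        rw [hsum n _ ω h]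
        exact abs_heatMean_le g _ _
      · simp only [H]
        rw [hsum0 n _ ω h]
        simp
    · filter_upwards [measure_eq_zero_iff_ae_notMem.1 hreg] with ω hω
      by_cases h : τ ω < t
      · rw [indicator_of_mem (show ω ∈ {ω | τ ω < t} from h)]
        set x := (τ ω).toNNReal with hx
        have hxτ : τ ω = x := (ENNReal.coe_toNNReal h.ne_top).symm
        have hx0 : 0 < x := by
          rw [pos_iff_ne_zero]
          intro h0
          exact hω (by rw [h0] at hxτ; simpa using hxτ)
        have hτr : (τ ω).toReal = x := by rw [hxτ]; rfl
        have hbx : B x ω = b x := eq_boundary_at_firstPassageTime (hBc ω) hb hx0 hxτ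
        let ρ : ℕ → ℝ≥0 := fun n => r n (⌊((n + 1 : ℕ) : ℝ≥0) * x / t⌋₊ + 1)
        have hρ : Tendsto ρ atTop (𝓝 x) := by
          have hup : Tendsto (fun n : ℕ => x + t * (1 / ((n : ℝ≥0) + 1))) atTop
              (𝓝 (x + t * 0)) :=
            (tendsto_one_div_add_atTop_nhds_zero_nat (𝕜 := ℝ≥0)).const_mul t |>.const_add x
          rw [mul_zero, add_zero] at hup
          refine tendsto_of_tendsto_of_tendsto_of_le_of_le tendsto_const_nhds hup ?_ ?_
          · intro n
            exact (((grid_cell_iff ht n.succ_pos _).2 rfl).2).le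
          · intro n
            have hn : (0 : ℝ≥0) < ((n + 1 : ℕ) : ℝ≥0) := by positivity
            have hfl := Nat.floor_le (a := ((n + 1 : ℕ) : ℝ≥0) * x / t) (by positivity)
            rw [le_div_iff₀ ht] at hfl
            simp only [ρ, r]
            rw [div_le_iff₀ hn]
            have : (x + t * (1 / ((n : ℝ≥0) + 1))) * ((n + 1 : ℕ) : ℝ≥0) =
                ((n + 1 : ℕ) : ℝ≥0) * x + t := by
              push_cast
              field_simp
            rw [this]
            push_cast at hfl ⊢
            rw [mul_add, mul_one, mul_comm t]
            gcongr
        have h2 : Tendsto (fun n => heatMean g (t - ρ n) (B (ρ n) ω)) atTop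
            (𝓝 (heatMean g (t - x) (B x ω))) :=
          ((continuous_heatMean g).tendsto (_, _)).comp
            ((tendsto_const_nhds.sub ((NNReal.continuous_coe.tendsto x).comp hρ)).prodMk_nhds
              (((hBc ω).tendsto x).comp hρ))
        rw [hτr, ← hbx]
        refine h2.congr fun n => ?_
        simp only [H]
        rw [hsum n _ ω h]
      · rw [indicator_of_notMem (show ω ∉ {ω | τ ω < t} from h)]
        refine tendsto_const_nhds.congr fun n => ?_
        simp only [H]
        rw [hsum0 n _ ω h]
  rw [← integral_indicator hT (f := fun ω => heatMean g (t - (τ ω).toReal) (b (τ ω).toReal))]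
  exact tendsto_nhds_unique (tendsto_const_nhds.congr hHeq) hlim

end Markov

section Law

variable {Ω : Type*} [MeasurableSpace Ω] {P : Measure Ω}

instance [IsFiniteMeasure P] (W : ℝ≥0 → Ω → ℝ) (b : ℝ → ℝ) : IsFiniteMeasure (firstPassageLaw P W b) := by
  unfold firstPassageLaw; infer_instance

lemma firstPassageLaw_restrict_Ioo {B : ℝ≥0 → Ω → ℝ} {b : ℝ → ℝ}
    (hτ : Measurable (firstPassageTime B b)) (hreg : P {ω | firstPassageTime B b ω = 0} = 0)
    (t : ℝ≥0) :
    (firstPassageLaw P B b).restrict (Ioo 0 (t : ℝ)) =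
      (P.restrict {ω | firstPassageTime B b ω < t}).map
        (fun ω => (firstPassageTime B b ω).toReal) := by
  have hS : MeasurableSet (ENNReal.toReal ⁻¹' Ioo 0 (t : ℝ)) :=
    ENNReal.measurable_toReal measurableSet_Ioo
  have hI : MeasurableSet ({∞}ᶜ : Set ℝ≥0∞) := (measurableSet_singleton _).compl
  rw [firstPassageLaw, Measure.restrict_map ENNReal.measurable_toReal measurableSet_Ioo,
    Measure.restrict_restrict hS, Measure.restrict_map hτ (hS.inter hI),
    Measure.map_map ENNReal.measurable_toReal hτ]
  congr 1
  refine Measure.restrict_congr_set ?_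
  filter_upwards [measure_eq_zero_iff_ae_notMem.1 hreg] with ω hω
  have h0 : firstPassageTime B b ω ≠ 0 := hω
  refine propext ?_
  change (0 < (firstPassageTime B b ω).toReal ∧ (firstPassageTime B b ω).toReal < t) ∧
    firstPassageTime B b ω ≠ ∞ ↔ firstPassageTime B b ω < t
  generalize firstPassageTime B b ω = x at h0
  induction x with
  | top => simp
  | coe x =>
    have : 0 < x := pos_iff_ne_zero.2 (by simpa using h0)
    simpa using fun _ => this

/-- The map `(s, z) ↦ b s + √(t - s) z`, whose image of `F(ds) ⊗ N(0, 1)` is the law of the value at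
time `t` of a Brownian motion restarted from the boundary at the first-passage time. -/
lemma aemeasurable_boundary_add {b : ℝ → ℝ} (hb : ContinuousOn b (Ioi 0)) (F : Measure ℝ)
    [IsFiniteMeasure F] (t : ℝ) :
    AEMeasurable (fun q : ℝ × ℝ => b q.1 + √(t - q.1) * q.2)
      ((F.restrict (Ioo 0 t)).prod (gaussianReal 0 1)) := by
  have h : (F.restrict (Ioo 0 t)).prod (gaussianReal 0 1) =
      (F.prod (gaussianReal 0 1)).restrict (Ioo 0 t ×ˢ univ) := by
    rw [← Measure.prod_restrict, Measure.restrict_univ]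
  rw [h]
  refine ContinuousOn.aemeasurable ?_ (measurableSet_Ioo.prod MeasurableSet.univ)
  refine ContinuousOn.add ?_ (by fun_prop)
  exact hb.comp continuous_fst.continuousOn fun q hq => hq.1.1

variable [IsProbabilityMeasure P]

/-- The law of `W t` on `{τ < t}` is that of a Brownian motion restarted from the boundary at the
first-passage time. -/
theorem map_restrict_firstPassageTime_lt {W : ℝ≥0 → Ω → ℝ} (hW : IsBrownianReal W P)
    {b : ℝ → ℝ} (hb : ContinuousOn b (Ioi 0)) (hreg : P {ω | firstPassageTime W b ω = 0} = 0)
    {t : ℝ≥0} (ht : 0 < t) :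
    (P.restrict {ω | firstPassageTime W b ω < t}).map (W t) =
      (((firstPassageLaw P W b).restrict (Ioo 0 (t : ℝ))).prod (gaussianReal 0 1)).map
        (fun q => b q.1 + √(t - q.1) * q.2) := by
  obtain ⟨B, hBm, hBc, hWB⟩ := exists_measurable_continuous_version hW
  have hB : IsPreBrownianReal B P :=
    hW.toIsPreBrownianReal.congr fun t => hWB.mono fun ω h => h t
  have hττ : firstPassageTime W b =ᵐ[P] firstPassageTime B b := by
    filter_upwards [hWB] with ω h
    simp only [firstPassageTime, h]
  have hregB : P {ω | firstPassageTime B b ω = 0} = 0 := by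
    refine (measure_congr ?_).trans hreg
    filter_upwards [hττ] with ω h
    exact propext (by change _ = (0 : ℝ≥0∞) ↔ _ = (0 : ℝ≥0∞); rw [h])
  have hset : P.restrict {ω | firstPassageTime W b ω < t} =
      P.restrict {ω | firstPassageTime B b ω < t} := by
    refine Measure.restrict_congr_set ?_
    filter_upwards [hττ] with ω h
    exact propext (by change _ < _ ↔ _ < _; rw [h])
  have hF : firstPassageLaw P W b = firstPassageLaw P B b := by
    rw [firstPassageLaw, firstPassageLaw, Measure.map_congr hττ]
  have hτm : Measurable (firstPassageTime B b) := measurable_firstPassageTime hBm hBc hb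
  rw [hset, hF, Measure.map_congr (ae_restrict_of_ae (hWB.mono fun ω h => h t))]
  refine ext_of_forall_integral_eq_of_IsFiniteMeasure fun g => ?_
  have hm := aemeasurable_boundary_add hb (firstPassageLaw P B b) t
  have hgm : AEStronglyMeasurable (fun q : ℝ × ℝ => g (b q.1 + √(t - q.1) * q.2))
      (((firstPassageLaw P B b).restrict (Ioo 0 (t : ℝ))).prod (gaussianReal 0 1)) :=
    (g.continuous.measurable.comp_aemeasurable hm).aestronglyMeasurable
  rw [integral_map (hBm t).aemeasurable g.continuous.aestronglyMeasurable,
    integral_map hm g.continuous.aestronglyMeasurable,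
    integral_firstPassageTime_lt_eq hB hBm hBc hb hregB g ht,
    integral_prod _ (Integrable.of_bound hgm ‖g‖ (ae_of_all _ fun q => g.norm_coe_le_norm _))]
  have hq : AEStronglyMeasurable (fun s => heatMean g (t - s) (b s))
      ((firstPassageLaw P B b).restrict (Ioo 0 (t : ℝ))) := by
    refine ContinuousOn.aestronglyMeasurable ?_ measurableSet_Ioo
    exact (continuous_heatMean g).comp_continuousOn (f := fun s => ((t : ℝ) - s, b s))
      (ContinuousOn.prodMk (by fun_prop) (hb.mono fun s hs => hs.1))
  change _ = ∫ s in Ioo 0 (t : ℝ), heatMean g (t - s) (b s) ∂(firstPassageLaw P B b)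
  rw [firstPassageLaw_restrict_Ioo hτm hregB] at hq ⊢
  rw [integral_map _ hq]
  exact (ENNReal.measurable_toReal.comp hτm).aemeasurable

/-- Below the boundary, the law of `W t` is that of a Brownian motion restarted from the boundary at
the first-passage time, because the path must have crossed the boundary before. -/
theorem lintegral_eq_lintegral_restart {W : ℝ≥0 → Ω → ℝ} (hW : IsBrownianReal W P)
    {b : ℝ → ℝ} (hb : ContinuousOn b (Ioi 0)) (hreg : P {ω | firstPassageTime W b ω = 0} = 0)
    {t : ℝ≥0} (ht : 0 < t) {g : ℝ → ℝ≥0∞} (hg : Measurable g) (hg0 : ∀ w, b t ≤ w → g w = 0) :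
    ∫⁻ z, g (√t * z) ∂(gaussianReal 0 1) =
      ∫⁻ s in Ioo 0 (t : ℝ), ∫⁻ z, g (b s + √(t - s) * z) ∂(gaussianReal 0 1)
        ∂(firstPassageLaw P W b) := by
  have hm := aemeasurable_boundary_add hb (firstPassageLaw P W b) t
  calc ∫⁻ z, g (√t * z) ∂(gaussianReal 0 1) = ∫⁻ w, g w ∂(gaussianReal 0 t) := by
        rw [gaussianReal_eq_map_sqrt_mul t, lintegral_map hg (by fun_prop)]
    _ = ∫⁻ ω, g (W t ω) ∂P := by
        rw [← (hW.hasLaw_eval t).map_eq, lintegral_map' hg.aemeasurable (hW.aemeasurable t)]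
    _ = ∫⁻ ω in {ω | firstPassageTime W b ω < t}, g (W t ω) ∂P := by
        obtain ⟨B, hBm, hBc, hWB⟩ := exists_measurable_continuous_version hW
        have hττ : firstPassageTime W b =ᵐ[P] firstPassageTime B b := by
          filter_upwards [hWB] with ω h
          simp only [firstPassageTime, h]
        have hset : P.restrict {ω | firstPassageTime W b ω < t} =
            P.restrict {ω | firstPassageTime B b ω < t} := by
          refine Measure.restrict_congr_set ?_
          filter_upwards [hττ] with ω h
          exact propext (by change _ < _ ↔ _ < _; rw [h])
        have hτm : Measurable (firstPassageTime B b) := measurable_firstPassageTime hBm hBc hb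
        rw [hset, ← lintegral_indicator (measurableSet_lt hτm measurable_const)]
        refine lintegral_congr_ae ?_
        filter_upwards [hWB] with ω h
        by_cases hω : firstPassageTime B b ω < t
        · rw [indicator_of_mem (show ω ∈ {ω | firstPassageTime B b ω < t} from hω)]
        · rw [indicator_of_notMem (show ω ∉ {ω | firstPassageTime B b ω < t} from hω)]
          refine hg0 _ (not_lt.1 fun hlt => hω ?_)
          exact firstPassageTime_lt_of_lt_boundary (hBc ω) hb ht (by rwa [← h t])
    _ = ∫⁻ w, g w ∂((P.restrict {ω | firstPassageTime W b ω < t}).map (W t)) :=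
        (lintegral_map' hg.aemeasurable (hW.aemeasurable t).restrict).symm
    _ = _ := by
        rw [map_restrict_firstPassageTime_lt hW hb hreg ht, lintegral_map' hg.aemeasurable hm,
          lintegral_prod (fun q : ℝ × ℝ => g (b q.1 + √(t - q.1) * q.2))
            (hg.comp_aemeasurable hm)]

end Law

/-! ### Gaussian moment integrals over a half-line -/

/-- The truncated Gaussian moment `∫₀^∞ e^{-(x+z)²/2} x^a dx`. -/
noncomputable def tailMoment (a z : ℝ) : ℝ :=
  ∫ x in Ioi (0 : ℝ), Real.exp (-(x + z) ^ 2 / 2) * x ^ a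

/-- The integral `∫₀^∞ (x+z) e^{-(x+z)²/2} x^a dx`, minus the derivative of `tailMoment a` at `z`. -/
noncomputable def tailMomentSlope (a z : ℝ) : ℝ :=
  ∫ x in Ioi (0 : ℝ), (x + z) * Real.exp (-(x + z) ^ 2 / 2) * x ^ a

lemma abs_mul_exp_neg_sq_half_le_quarter (w : ℝ) :
    |w| * Real.exp (-w ^ 2 / 2) ≤ Real.exp (-w ^ 2 / 4) := by
  have h1 : |w| ≤ Real.exp (w ^ 2 / 4) := by
    have := Real.add_one_le_exp (w ^ 2 / 4)
    nlinarith [sq_nonneg (|w| / 2 - 1), sq_abs w]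
  calc |w| * Real.exp (-w ^ 2 / 2) ≤ Real.exp (w ^ 2 / 4) * Real.exp (-w ^ 2 / 2) := by gcongr
    _ = Real.exp (-w ^ 2 / 4) := by rw [← Real.exp_add]; congr 1; ring

lemma abs_mul_exp_neg_sq_half_le (w : ℝ) :
    |w| * Real.exp (-w ^ 2 / 2) ≤ Real.exp (1 - w) :=
  (abs_mul_exp_neg_sq_half_le_quarter w).trans
    (Real.exp_le_exp.2 (by nlinarith [sq_nonneg (w - 2)]))

lemma pow_three_mul_exp_neg_sq_half_le {w : ℝ} (hw : 0 ≤ w) :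
    w ^ 3 * Real.exp (-w ^ 2 / 2) ≤ 8 * Real.exp (1 - w) := by
  have h1 : w ≤ 2 * Real.exp (w ^ 2 / 12) := by
    have := Real.add_one_le_exp (w ^ 2 / 12)
    nlinarith [sq_nonneg (w / 3 - 1), sq_abs w]
  have h2 : w ^ 3 ≤ 8 * Real.exp (w ^ 2 / 4) := by
    calc w ^ 3 ≤ (2 * Real.exp (w ^ 2 / 12)) ^ 3 := by gcongr
      _ = 8 * Real.exp (w ^ 2 / 4) := by
        rw [mul_pow, ← Real.exp_nat_mul]; norm_num; ring_nf
  calc w ^ 3 * Real.exp (-w ^ 2 / 2)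
      ≤ 8 * Real.exp (w ^ 2 / 4) * Real.exp (-w ^ 2 / 2) := by gcongr
    _ = 8 * Real.exp (-w ^ 2 / 4) := by
        rw [mul_assoc, ← Real.exp_add]; congr 2; ring
    _ ≤ 8 * Real.exp (1 - w) := by
        gcongr; nlinarith [sq_nonneg (w - 2)]

lemma integrableOn_exp_neg_mul_rpow {a : ℝ} (ha : -1 < a) :
    IntegrableOn (fun x : ℝ => Real.exp (-x) * x ^ a) (Ioi 0) := by
  simpa using Real.GammaIntegral_convergent (s := a + 1) (by linarith)

lemma aestronglyMeasurable_mul_rpow {h : ℝ → ℝ} (hh : Continuous h) (a : ℝ) :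
    AEStronglyMeasurable (fun x : ℝ => h x * x ^ a) (volume.restrict (Ioi 0)) :=
  (hh.measurable.mul (measurable_id.pow_const a)).aestronglyMeasurable

lemma integrableOn_tailMoment {a : ℝ} (ha : -1 < a) (z : ℝ) :
    IntegrableOn (fun x : ℝ => Real.exp (-(x + z) ^ 2 / 2) * x ^ a) (Ioi 0) := by
  refine ((integrableOn_exp_neg_mul_rpow ha).const_mul (Real.exp (1 - z))).mono'
    (aestronglyMeasurable_mul_rpow (by fun_prop) a) ?_
  filter_upwards [ae_restrict_mem measurableSet_Ioi] with x hx
  have hx' : (0 : ℝ) < x := hx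
  rw [Real.norm_of_nonneg (by positivity), ← mul_assoc, ← Real.exp_add]
  gcongr
  nlinarith [sq_nonneg (x + z - 1)]

lemma integrableOn_tailMomentSlope {a : ℝ} (ha : -1 < a) (z : ℝ) :
    IntegrableOn (fun x : ℝ => (x + z) * Real.exp (-(x + z) ^ 2 / 2) * x ^ a) (Ioi 0) := by
  refine ((integrableOn_exp_neg_mul_rpow ha).const_mul (Real.exp (1 - z))).mono'
    (aestronglyMeasurable_mul_rpow (by fun_prop) a) ?_
  filter_upwards [ae_restrict_mem measurableSet_Ioi] with x hx
  have hx' : (0 : ℝ) < x := hx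
  rw [norm_mul, norm_mul, Real.norm_eq_abs, Real.norm_of_nonneg (Real.exp_pos _).le,
    Real.norm_of_nonneg (by positivity), ← mul_assoc, ← Real.exp_add]
  gcongr
  exact (abs_mul_exp_neg_sq_half_le (x + z)).trans_eq (congrArg _ (by ring))

lemma hasDerivAt_tailMoment {a : ℝ} (ha : -1 < a) (z : ℝ) :
    HasDerivAt (tailMoment a) (-tailMomentSlope a z) z := by
  have h := hasDerivAt_integral_of_dominated_loc_of_deriv_le (μ := volume.restrict (Ioi 0))
    (F := fun z x : ℝ => Real.exp (-(x + z) ^ 2 / 2) * x ^ a)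
    (F' := fun z x : ℝ => -((x + z) * Real.exp (-(x + z) ^ 2 / 2) * x ^ a))
    (x₀ := z) (s := Metric.ball z 1)
    (bound := fun x => Real.exp (2 - z) * (Real.exp (-x) * x ^ a))
    (Metric.ball_mem_nhds z one_pos)
    (Eventually.of_forall fun y => (integrableOn_tailMoment ha y).aestronglyMeasurable)
    (integrableOn_tailMoment ha z) (integrableOn_tailMomentSlope ha z).aestronglyMeasurable.neg
    ?_ ((integrableOn_exp_neg_mul_rpow ha).const_mul _) ?_
  · rw [integral_neg] at h
    exact h.2
  · filter_upwards [ae_restrict_mem measurableSet_Ioi] with x hx y hy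
    have hx' : (0 : ℝ) < x := hx
    rw [Metric.mem_ball, Real.dist_eq, abs_lt] at hy
    rw [norm_neg, norm_mul, norm_mul, Real.norm_eq_abs, Real.norm_of_nonneg (Real.exp_pos _).le,
      Real.norm_of_nonneg (by positivity), ← mul_assoc, ← Real.exp_add]
    gcongr
    refine (abs_mul_exp_neg_sq_half_le (x + y)).trans (Real.exp_le_exp.2 ?_)
    linarith
  · refine ae_of_all _ fun x y _ => ?_
    have h1 : HasDerivAt (fun y : ℝ => -(x + y) ^ 2 / 2) (-(x + y)) y := by
      exact (((hasDerivAt_id y).const_add x).pow 2).neg.div_const 2 |>.congr_deriv (by simp; ring)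
    exact (h1.exp.mul_const (x ^ a)).congr_deriv (by ring)

lemma continuous_tailMoment {a : ℝ} (ha : -1 < a) : Continuous (tailMoment a) :=
  continuous_iff_continuousAt.2 fun z => (hasDerivAt_tailMoment ha z).continuousAt

lemma continuous_tailMomentSlope {a : ℝ} (ha : -1 < a) : Continuous (tailMomentSlope a) := by
  refine continuous_iff_continuousAt.2 fun z => ?_
  refine continuousAt_of_dominated (bound := fun x => Real.exp (2 - z) * (Real.exp (-x) * x ^ a))
    (Eventually.of_forall fun y => (integrableOn_tailMomentSlope ha y).aestronglyMeasurable)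
    ?_ ((integrableOn_exp_neg_mul_rpow ha).const_mul _)
    (ae_of_all _ fun x => Continuous.continuousAt (by fun_prop))
  filter_upwards [Metric.ball_mem_nhds z one_pos] with y hy
  filter_upwards [ae_restrict_mem measurableSet_Ioi] with x hx
  have hx' : (0 : ℝ) < x := hx
  rw [Metric.mem_ball, Real.dist_eq, abs_lt] at hy
  rw [norm_mul, norm_mul, Real.norm_eq_abs, Real.norm_of_nonneg (Real.exp_pos _).le,
    Real.norm_of_nonneg (by positivity), ← mul_assoc, ← Real.exp_add]
  gcongr
  refine (abs_mul_exp_neg_sq_half_le (x + y)).trans (Real.exp_le_exp.2 ?_)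
  linarith

lemma tailMoment_nonneg (a z : ℝ) : 0 ≤ tailMoment a z := by
  refine setIntegral_nonneg measurableSet_Ioi fun x hx => ?_
  have hx' : (0 : ℝ) < x := hx
  positivity

lemma tailMomentSlope_nonneg (a : ℝ) {z : ℝ} (hz : 0 ≤ z) : 0 ≤ tailMomentSlope a z := by
  refine setIntegral_nonneg measurableSet_Ioi fun x hx => ?_
  have hx' : (0 : ℝ) < x := hx
  positivity

lemma tailMomentSlope_zero_pos {a : ℝ} (ha : -1 < a) : 0 < tailMomentSlope a 0 := by
  refine (setIntegral_pos_iff_support_of_nonneg_ae ?_ (integrableOn_tailMomentSlope ha 0)).2 ?_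
  · filter_upwards [ae_restrict_mem measurableSet_Ioi] with x hx
    have hx' : (0 : ℝ) < x := hx
    simp only [Pi.zero_apply]
    positivity
  · have : Ioi (0 : ℝ) ⊆ Function.support
        (fun x : ℝ => (x + 0) * Real.exp (-(x + 0) ^ 2 / 2) * x ^ a) := by
      intro x hx
      have hx' : (0 : ℝ) < x := hx
      rw [Function.mem_support]
      positivity
    rw [inter_eq_right.2 this]
    simp

lemma tailMomentSlope_bounded {a : ℝ} (ha : -1 < a) (ha0 : a ≤ 0) :
    ∃ C, ∀ z, |tailMomentSlope a z| ≤ C := by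
  have hint : Integrable fun w : ℝ => Real.exp (-w ^ 2 / 4) := by
    have := integrable_exp_neg_mul_sq (b := 1 / 4) (by norm_num)
    refine this.congr (ae_of_all _ fun w => ?_)
    simp only
    congr 1; ring
  have hpow : IntegrableOn (fun x : ℝ => x ^ a) (Ioc 0 1) :=
    (intervalIntegral.intervalIntegrable_rpow' ha).1
  have hpow' : Integrable ((Ioc (0 : ℝ) 1).indicator fun x : ℝ => x ^ a)
      (volume.restrict (Ioi 0)) :=
    (hpow.integrable_indicator measurableSet_Ioc).restrict
  refine ⟨(∫ x in Ioi 0, (Ioc (0 : ℝ) 1).indicator (fun x : ℝ => x ^ a) x) +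
    ∫ w : ℝ, Real.exp (-w ^ 2 / 4), fun z => ?_⟩
  have hz : Integrable fun x : ℝ => Real.exp (-(x + z) ^ 2 / 4) := hint.comp_add_right z
  calc |tailMomentSlope a z|
      ≤ ∫ x in Ioi 0, ((Ioc (0 : ℝ) 1).indicator (fun x : ℝ => x ^ a) x +
          Real.exp (-(x + z) ^ 2 / 4)) := by
        refine (Real.norm_eq_abs _).symm.trans_le (norm_integral_le_of_norm_le (hpow'.add hz.restrict) ?_)
        filter_upwards [ae_restrict_mem measurableSet_Ioi] with x hx
        have hx' : (0 : ℝ) < x := hx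
        rw [norm_mul, norm_mul, Real.norm_eq_abs, Real.norm_of_nonneg (Real.exp_pos _).le,
          Real.norm_of_nonneg (by positivity)]
        have h1 := abs_mul_exp_neg_sq_half_le_quarter (x + z)
        by_cases hx1 : x ≤ 1
        · rw [indicator_of_mem (show x ∈ Ioc (0 : ℝ) 1 from ⟨hx', hx1⟩)]
          have h2 : Real.exp (-(x + z) ^ 2 / 4) ≤ 1 :=
            Real.exp_le_one_iff.2 (by nlinarith [sq_nonneg (x + z)])
          have h3 : 0 ≤ x ^ a := by positivity
          have h4 := Real.exp_pos (-(x + z) ^ 2 / 4)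
          nlinarith
        · rw [indicator_of_notMem (fun h : x ∈ Ioc (0 : ℝ) 1 => hx1 h.2), zero_add]
          have h2 : x ^ a ≤ 1 := Real.rpow_le_one_of_one_le_of_nonpos (not_le.1 hx1).le ha0
          calc |x + z| * Real.exp (-(x + z) ^ 2 / 2) * x ^ a
              ≤ Real.exp (-(x + z) ^ 2 / 4) * 1 := by gcongr
            _ = _ := mul_one _
    _ = (∫ x in Ioi 0, (Ioc (0 : ℝ) 1).indicator (fun x : ℝ => x ^ a) x) +
          ∫ x in Ioi 0, Real.exp (-(x + z) ^ 2 / 4) := integral_add hpow' hz.restrict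
    _ ≤ _ := by
        gcongr
        refine (setIntegral_le_integral hz (ae_of_all _ fun x => (Real.exp_pos _).le)).trans_eq ?_
        exact integral_add_right_eq_self (fun w : ℝ => Real.exp (-w ^ 2 / 4)) z

lemma sq_mul_tailMomentSlope_bounded {a : ℝ} (ha : -1 < a) :
    ∃ C, ∀ z, 0 ≤ z → z ^ 2 * |tailMomentSlope a z| ≤ C := by
  refine ⟨∫ x in Ioi 0, 8 * Real.exp 1 * (Real.exp (-x) * x ^ a), fun z hz => ?_⟩
  rw [← abs_of_nonneg (sq_nonneg z), ← abs_mul, tailMomentSlope, ← integral_const_mul]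
  refine (Real.norm_eq_abs _).symm.trans_le
    (norm_integral_le_of_norm_le ((integrableOn_exp_neg_mul_rpow ha).const_mul _) ?_)
  filter_upwards [ae_restrict_mem measurableSet_Ioi] with x hx
  have hx' : (0 : ℝ) < x := hx
  rw [Real.norm_of_nonneg (by positivity)]
  calc z ^ 2 * ((x + z) * Real.exp (-(x + z) ^ 2 / 2) * x ^ a)
      ≤ (x + z) ^ 2 * ((x + z) * Real.exp (-(x + z) ^ 2 / 2) * x ^ a) := by
        gcongr; linarith
    _ = (x + z) ^ 3 * Real.exp (-(x + z) ^ 2 / 2) * x ^ a := by ring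
    _ ≤ 8 * Real.exp (1 - (x + z)) * x ^ a := by
        exact mul_le_mul_of_nonneg_right (pow_three_mul_exp_neg_sq_half_le (by linarith))
          (by positivity)
    _ ≤ 8 * (Real.exp 1 * Real.exp (-x)) * x ^ a := by
        rw [← Real.exp_add]; gcongr; linarith
    _ = _ := by ring

/-! ### The parabolic cylinder kernel -/

/-- The function `e^{-z²/4} D_p(z)`. -/
noncomputable def weightedD (p z : ℝ) : ℝ := Real.exp (-z ^ 2 / 4) * parabolicCylinderD p z

lemma weightedD_of_neg {p : ℝ} (hp : p < 0) (z : ℝ) :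
    weightedD p z = tailMoment (-p - 1) z / Real.Gamma (-p) := by
  rw [weightedD, parabolicCylinderD, if_pos hp, tailMoment, ← mul_assoc, ← integral_const_mul,
    ← integral_div]
  congr 1 with x
  have : Real.exp (-(x + z) ^ 2 / 2) =
      Real.exp (-z ^ 2 / 4) * Real.exp (-z ^ 2 / 4) * Real.exp (-x * z - x ^ 2 / 2) := by
    rw [← Real.exp_add, ← Real.exp_add]; congr 1; ring
  rw [this]
  ring

/-- The recurrence, for orders in `[0, 1)`, shows that `e^{-z²/4} D_p(z)` is minus the derivative of
`e^{-z²/4} D_{p-1}(z)`. -/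
lemma weightedD_of_nonneg {p : ℝ} (hp : 0 ≤ p) (hp1 : p < 1) (z : ℝ) :
    weightedD p z = tailMomentSlope (-p) z / Real.Gamma (1 - p) := by
  have hΓ : Real.Gamma (2 - p) = (1 - p) * Real.Gamma (1 - p) := by
    rw [show 2 - p = (1 - p) + 1 by ring, Real.Gamma_add_one (by linarith)]
  have h0 : 0 < Real.Gamma (1 - p) := Real.Gamma_pos_of_pos (by linarith)
  have h1 : tailMomentSlope (-p) z = tailMoment (1 - p) z + z * tailMoment (-p) z := by
    rw [tailMomentSlope, tailMoment, tailMoment, ← integral_const_mul,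
      ← integral_add (integrableOn_tailMoment (by linarith) z)
        ((integrableOn_tailMoment (by linarith) z).const_mul z)]
    refine setIntegral_congr_fun measurableSet_Ioi fun x hx => ?_
    have hx' : (0 : ℝ) < x := hx
    rw [show 1 - p = -p + 1 by ring, Real.rpow_add_one hx'.ne']
    ring
  have h2 := weightedD_of_neg (p := p - 1) (by linarith) z
  have h3 := weightedD_of_neg (p := p - 2) (by linarith) z
  rw [show -(p - 1) - 1 = -p by ring, show -(p - 1) = 1 - p by ring] at h2
  rw [show -(p - 2) - 1 = 1 - p by ring, show -(p - 2) = 2 - p by ring, hΓ] at h3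
  have h4 : weightedD p z = z * weightedD (p - 1) z - (p - 1) * weightedD (p - 2) z := by
    rw [weightedD, parabolicCylinderD, if_neg (not_lt.2 hp), weightedD, weightedD]
    ring
  rw [h4, h2, h3, h1]
  have : 1 - p ≠ 0 := by linarith
  field_simp
  ring

lemma continuous_weightedD {p : ℝ} (hp : p < 1) : Continuous (weightedD p) := by
  rcases lt_or_ge p 0 with h | h
  · rw [funext (weightedD_of_neg h)]
    exact (continuous_tailMoment (by linarith)).div_const _
  · rw [funext (weightedD_of_nonneg h hp)]
    exact (continuous_tailMomentSlope (by linarith)).div_const _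

lemma hasDerivAt_weightedD {p : ℝ} (hp : 0 ≤ p) (hp1 : p < 1) (z : ℝ) :
    HasDerivAt (weightedD (p - 1)) (-weightedD p z) z := by
  rw [funext (weightedD_of_neg (p := p - 1) (by linarith)), weightedD_of_nonneg hp hp1,
    ← neg_div]
  have := (hasDerivAt_tailMoment (a := -(p - 1) - 1) (by linarith) z).div_const
    (Real.Gamma (-(p - 1)))
  rwa [show -(p - 1) - 1 = -p by ring, show -(p - 1) = 1 - p by ring] at *

lemma weightedD_bounded {p : ℝ} (hp : 0 ≤ p) (hp1 : p < 1) : ∃ C, ∀ z, |weightedD p z| ≤ C := by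
  obtain ⟨C, hC⟩ := tailMomentSlope_bounded (a := -p) (by linarith) (by linarith)
  have h0 : 0 < Real.Gamma (1 - p) := Real.Gamma_pos_of_pos (by linarith)
  refine ⟨C / Real.Gamma (1 - p), fun z => ?_⟩
  rw [weightedD_of_nonneg hp hp1, abs_div, abs_of_pos h0]
  gcongr
  exact hC z

lemma sq_mul_weightedD_bounded {p : ℝ} (hp : 0 ≤ p) (hp1 : p < 1) :
    ∃ C, ∀ z, 0 ≤ z → z ^ 2 * |weightedD p z| ≤ C := by
  obtain ⟨C, hC⟩ := sq_mul_tailMomentSlope_bounded (a := -p) (by linarith)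
  have h0 : 0 < Real.Gamma (1 - p) := Real.Gamma_pos_of_pos (by linarith)
  refine ⟨C / Real.Gamma (1 - p), fun z hz => ?_⟩
  rw [weightedD_of_nonneg hp hp1, abs_div, abs_of_pos h0, ← mul_div_assoc]
  gcongr
  exact hC z hz

/-- For `0 ≤ p < 1`, the function `e^{-z²/4} D_p(z)` is nonnegative on the positive half-line and
bounded below by a positive constant near `0`. -/
lemma exists_weightedD_lower_bound {p : ℝ} (hp : 0 ≤ p) (hp1 : p < 1) :
    ∃ δ c, 0 < δ ∧ 0 < c ∧ (∀ z, |z| ≤ δ → c ≤ weightedD p z) ∧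
      ∀ z, -δ ≤ z → 0 ≤ weightedD p z := by
  have h0 : 0 < Real.Gamma (1 - p) := Real.Gamma_pos_of_pos (by linarith)
  have hpos : 0 < weightedD p 0 := by
    rw [weightedD_of_nonneg hp hp1]
    exact div_pos (tailMomentSlope_zero_pos (by linarith)) h0
  have hev : ∀ᶠ z in 𝓝 (0 : ℝ), weightedD p 0 / 2 < weightedD p z :=
    (continuous_weightedD hp1).continuousAt.eventually_const_lt (by linarith)
  obtain ⟨δ, hδ, hball⟩ := Metric.nhds_basis_closedBall.mem_iff.1 hev
  have hnear : ∀ z, |z| ≤ δ → weightedD p 0 / 2 ≤ weightedD p z := fun z hz =>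
    (hball (by simpa using hz) : weightedD p 0 / 2 < weightedD p z).le
  refine ⟨δ, weightedD p 0 / 2, hδ, by linarith, hnear, fun z hz => ?_⟩
  rcases le_total 0 z with hz0 | hz0
  · rw [weightedD_of_nonneg hp hp1]
    exact div_nonneg (tailMomentSlope_nonneg _ hz0) h0.le
  · have := hnear z (by rw [abs_of_nonpos hz0]; linarith)
    linarith

/-- The kernel of the integral equations: order `p`, elapsed time `v`, displacement `d`. -/
noncomputable def cylinderKernel (p v d : ℝ) : ℝ :=
  Real.exp (-d ^ 2 / (4 * v)) * (parabolicCylinderD p (d / √v) / v ^ ((p + 1) / 2))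

lemma cylinderKernel_eq {p v : ℝ} (hv : 0 < v) (d : ℝ) :
    cylinderKernel p v d = weightedD p (d / √v) / v ^ ((p + 1) / 2) := by
  rw [cylinderKernel, weightedD, mul_div_assoc, div_pow, Real.sq_sqrt hv.le]
  congr 2
  field_simp

lemma continuousOn_cylinderKernel {p : ℝ} (hp : p < 1) :
    ContinuousOn (fun q : ℝ × ℝ => cylinderKernel p q.1 q.2) (Ioi 0 ×ˢ univ) := by
  have h : ContinuousOn (fun q : ℝ × ℝ => weightedD p (q.2 / √q.1) / q.1 ^ ((p + 1) / 2))
      (Ioi 0 ×ˢ univ) := by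
    refine ContinuousOn.div ?_ ?_ ?_
    · refine (continuous_weightedD hp).comp_continuousOn (ContinuousOn.div (by fun_prop)
        (by fun_prop) ?_)
      rintro ⟨v, d⟩ ⟨hv, -⟩
      exact (Real.sqrt_pos.2 hv).ne'
    · refine ContinuousOn.rpow_const (by fun_prop) ?_
      rintro ⟨v, d⟩ ⟨hv, -⟩
      exact Or.inl (ne_of_gt hv)
    · rintro ⟨v, d⟩ ⟨hv, -⟩
      exact (Real.rpow_pos_of_pos hv _).ne'
  refine h.congr ?_
  rintro ⟨v, d⟩ ⟨hv, -⟩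
  exact cylinderKernel_eq hv d

lemma cylinderKernel_nonneg {p v : ℝ} (hp : p < 0) (hv : 0 < v) (d : ℝ) :
    0 ≤ cylinderKernel p v d := by
  rw [cylinderKernel_eq hv, weightedD_of_neg hp]
  have := tailMoment_nonneg (-p - 1) (d / √v)
  have := Real.Gamma_pos_of_pos (neg_pos.2 hp)
  positivity

lemma hasDerivAt_cylinderKernel {p v : ℝ} (hp : 0 ≤ p) (hp1 : p < 1) (hv : 0 < v) (a y : ℝ) :
    HasDerivAt (fun y => cylinderKernel (p - 1) v (a - y)) (cylinderKernel p v (a - y)) y := by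
  have h1 : HasDerivAt (fun y : ℝ => (a - y) / √v) (-1 / √v) y :=
    ((hasDerivAt_id y).const_sub a).div_const _
  have h2 := ((hasDerivAt_weightedD hp hp1 ((a - y) / √v)).comp y h1).div_const
    (v ^ ((p - 1 + 1) / 2))
  rw [funext fun y => cylinderKernel_eq hv (p := p - 1) (a - y), cylinderKernel_eq hv]
  refine h2.congr_deriv ?_
  have h3 : v ^ ((p + 1) / 2) = v ^ ((p - 1 + 1) / 2) * √v := by
    rw [Real.sqrt_eq_rpow, ← Real.rpow_add hv]; congr 1; ring
  have h4 := Real.sqrt_pos.2 hv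
  have h5 := Real.rpow_pos_of_pos hv ((p - 1 + 1) / 2)
  rw [h3]
  field_simp

/-- For order `q < 0` the kernel is, up to a constant, the mean of `(y - X)₊^{-q-1}` for a Gaussian
variable `X` with mean `a` and variance `v`. -/
lemma lintegral_truncated_power {q v : ℝ} (hq : q < 0) (hv : 0 < v) (a y : ℝ) :
    ∫⁻ z, (Iio y).indicator (fun w => ENNReal.ofReal ((y - w) ^ (-q - 1))) (a + √v * z)
        ∂(gaussianReal 0 1) =
      ENNReal.ofReal (Real.Gamma (-q) / √(2 * Real.pi) * cylinderKernel q v (a - y)) := by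
  have hsv := Real.sqrt_pos.2 hv
  have hΓ := Real.Gamma_pos_of_pos (neg_pos.2 hq)
  set ζ := (y - a) / √v with hζ
  have hyζ : y = a + √v * ζ := by rw [hζ]; field_simp; ring
  set G : ℝ → ℝ≥0∞ := (Iio y).indicator fun w => ENNReal.ofReal ((y - w) ^ (-q - 1)) with hG
  have hGm : Measurable G := by
    refine Measurable.indicator ?_ measurableSet_Iio
    exact ((measurable_const.sub measurable_id).pow_const _).ennreal_ofReal
  rw [gaussianReal_of_var_ne_zero _ one_ne_zero,
    lintegral_withDensity_eq_lintegral_mul _ (measurable_gaussianPDF 0 1)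
      (g := fun z => G (a + √v * z)) (hGm.comp (by fun_prop : Measurable fun z => a + √v * z)),
    ← lintegral_sub_left_eq_self _ ζ]
  have hpt : ∀ x, (gaussianPDF 0 1 * fun z => G (a + √v * z)) (ζ - x) =
      (Ioi 0).indicator (fun x => ENNReal.ofReal ((√(2 * Real.pi))⁻¹ * √v ^ (-q - 1) *
        (Real.exp (-(x + (a - y) / √v) ^ 2 / 2) * x ^ (-q - 1)))) x := by
    intro x
    rw [Pi.mul_apply]
    have hx : a + √v * (ζ - x) = y - √v * x := by rw [hyζ]; ring
    rw [hx]
    by_cases h : 0 < x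
    · have h' : y - √v * x ∈ Iio y := by
        simp only [mem_Iio]; nlinarith [mul_pos hsv h]
      rw [indicator_of_mem (show x ∈ Ioi (0 : ℝ) from h), hG, indicator_of_mem h',
        gaussianPDF, ← ENNReal.ofReal_mul (gaussianPDFReal_nonneg _ _ _), sub_sub_cancel,
        Real.mul_rpow hsv.le h.le, gaussianPDFReal]
      congr 1
      have : (a - y) / √v = -ζ := by rw [hζ]; ring
      rw [this]
      simp only [NNReal.coe_one, mul_one, sub_zero]
      rw [show -(ζ - x) ^ 2 = -(x + -ζ) ^ 2 by ring]
      ring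
    · have h' : y - √v * x ∉ Iio y := by
        simp only [mem_Iio, not_lt]; nlinarith [mul_nonneg hsv.le (sub_nonneg.2 (not_lt.1 h))]
      rw [indicator_of_notMem (show x ∉ Ioi (0 : ℝ) from h), hG, indicator_of_notMem h', mul_zero]
  rw [lintegral_congr hpt, lintegral_indicator measurableSet_Ioi,
    ← ofReal_integral_eq_lintegral_ofReal, integral_const_mul]
  · congr 1
    rw [cylinderKernel_eq hv, weightedD_of_neg hq]
    change _ * tailMoment (-q - 1) ((a - y) / √v) = _
    generalize tailMoment (-q - 1) ((a - y) / √v) = I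
    have h1 : √v ^ (-q - 1) = (v ^ ((q + 1) / 2))⁻¹ := by
      rw [Real.sqrt_eq_rpow, ← Real.rpow_mul hv.le, ← Real.rpow_neg hv.le]; congr 1; ring
    rw [h1]
    have := Real.rpow_pos_of_pos hv ((q + 1) / 2)
    have : 0 < √(2 * Real.pi) := Real.sqrt_pos.2 (by positivity)
    field_simp
  · exact (integrableOn_tailMoment (by linarith) _).const_mul _
  · filter_upwards [ae_restrict_mem measurableSet_Ioi] with x hx
    have hx' : (0 : ℝ) < x := hx
    simp only [Pi.zero_apply]
    positivity

/-! ### The integral equations of negative order -/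

/-- The integral equation of order `p` at time `t` at an arbitrary level `y`. -/
def LevelVolterraEq (F : Measure ℝ) (b : ℝ → ℝ) (p t y : ℝ) : Prop :=
  IntegrableOn (fun s => cylinderKernel p (t - s) (b s - y)) (Ioo 0 t) F ∧
    cylinderKernel p t (-y) = ∫ s in Ioo 0 t, cylinderKernel p (t - s) (b s - y) ∂F

lemma LevelVolterraEq.boundary {F : Measure ℝ} {b : ℝ → ℝ} {p t : ℝ}
    (h : LevelVolterraEq F b p t (b t)) : BoundaryVolterraEq F b p t := by
  refine ⟨h.1, Eq.trans ?_ h.2⟩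
  rw [cylinderKernel, mul_div_assoc, neg_sq]

lemma continuousOn_cylinderKernel_boundary {p : ℝ} (hp : p < 1) {b : ℝ → ℝ}
    (hb : ContinuousOn b (Ioi 0)) (t y : ℝ) :
    ContinuousOn (fun s => cylinderKernel p (t - s) (b s - y)) (Ioo 0 t) := by
  refine (continuousOn_cylinderKernel hp).comp (f := fun s => (t - s, b s - y)) ?_ ?_
  · exact ContinuousOn.prodMk (by fun_prop) ((hb.mono fun s hs => hs.1).sub continuousOn_const)
  · exact fun s hs => ⟨sub_pos.2 hs.2, mem_univ _⟩

lemma aestronglyMeasurable_cylinderKernel_boundary {p : ℝ} (hp : p < 1) {b : ℝ → ℝ}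
    (hb : ContinuousOn b (Ioi 0)) (t y : ℝ) (F : Measure ℝ) :
    AEStronglyMeasurable (fun s => cylinderKernel p (t - s) (b s - y)) (F.restrict (Ioo 0 t)) :=
  (continuousOn_cylinderKernel_boundary hp hb t y).aestronglyMeasurable measurableSet_Ioo

/-- The integral equations of negative order at levels up to the boundary, from the mean of
`(y - W t)₊^{-q-1}` conditioned at the first-passage time. This function is nonnegative, so
the integrability of the kernel is part of the conclusion. -/
theorem levelVolterraEq_of_neg {Ω : Type*} [MeasurableSpace Ω] {P : Measure Ω}
    [IsProbabilityMeasure P] {W : ℝ≥0 → Ω → ℝ} (hW : IsBrownianReal W P)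
    {b : ℝ → ℝ} (hb : ContinuousOn b (Ioi 0)) (hreg : P {ω | firstPassageTime W b ω = 0} = 0)
    {q t y : ℝ} (hq : q < 0) (ht : 0 < t) (hy : y ≤ b t) :
    LevelVolterraEq (firstPassageLaw P W b) b q t y := by
  lift t to ℝ≥0 using ht.le
  have ht' : 0 < t := by exact_mod_cast ht
  set c := Real.Gamma (-q) / √(2 * Real.pi) with hc
  have hc0 : 0 < c := div_pos (Real.Gamma_pos_of_pos (neg_pos.2 hq))
    (Real.sqrt_pos.2 (by positivity))
  have hGm : Measurable ((Iio y).indicator fun w : ℝ => ENNReal.ofReal ((y - w) ^ (-q - 1))) :=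
    Measurable.indicator ((measurable_const.sub measurable_id).pow_const _).ennreal_ofReal
      measurableSet_Iio
  have h := lintegral_eq_lintegral_restart hW hb hreg ht' hGm fun w hw =>
    indicator_of_notMem (show w ∉ Iio y from not_lt.2 (hy.trans hw)) _
  have hl := lintegral_truncated_power hq ht 0 y
  simp only [zero_add, zero_sub] at hl
  rw [hl, setLIntegral_congr_fun measurableSet_Ioo fun s hs =>
    lintegral_truncated_power hq (sub_pos.2 hs.2) (b s) y] at h
  have hm := (aestronglyMeasurable_cylinderKernel_boundary (by linarith : q < 1) hb t y
    (firstPassageLaw P W b)).const_mul c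
  have hnn : 0 ≤ᵐ[(firstPassageLaw P W b).restrict (Ioo 0 (t : ℝ))]
      fun s => c * cylinderKernel q (t - s) (b s - y) := by
    filter_upwards [ae_restrict_mem measurableSet_Ioo] with s hs
    exact mul_nonneg hc0.le (cylinderKernel_nonneg hq (sub_pos.2 hs.2) _)
  have hint : Integrable (fun s => c * cylinderKernel q (t - s) (b s - y))
      ((firstPassageLaw P W b).restrict (Ioo 0 (t : ℝ))) := by
    refine ⟨hm, ?_⟩
    rw [hasFiniteIntegral_iff_ofReal hnn, ← h]
    exact ENNReal.ofReal_lt_top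
  refine ⟨(integrable_const_mul_iff (isUnit_iff_ne_zero.2 hc0.ne') _).1 hint, ?_⟩
  rw [← ofReal_integral_eq_lintegral_ofReal hint hnn,
    ENNReal.ofReal_eq_ofReal_iff (mul_nonneg hc0.le (cylinderKernel_nonneg hq ht _))
      (integral_nonneg_of_ae hnn), integral_const_mul] at h
  exact mul_left_cancel₀ hc0.ne' h

/-! ### The integral equations of order in `[0, 1)` -/

lemma exists_abs_cylinderKernel_le {p : ℝ} (hp : 0 ≤ p) (hp1 : p < 1) :
    ∃ C, 0 ≤ C ∧ ∀ v d, 0 < v → |cylinderKernel p v d| ≤ C * v ^ (-((p + 1) / 2)) := by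
  obtain ⟨C, hC⟩ := weightedD_bounded hp hp1
  refine ⟨C, (abs_nonneg _).trans (hC 0), fun v d hv => ?_⟩
  have := Real.rpow_pos_of_pos hv ((p + 1) / 2)
  rw [cylinderKernel_eq hv, abs_div, abs_of_pos this, Real.rpow_neg hv.le, div_eq_mul_inv]
  gcongr
  exact hC _

/-- At a positive displacement, the kernel stays bounded as the elapsed time tends to `0`. -/
lemma exists_abs_cylinderKernel_le_of_pos {p : ℝ} (hp : 0 ≤ p) (hp1 : p < 1) :
    ∃ C, 0 ≤ C ∧ ∀ v d, 0 < v → 0 < d →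
      |cylinderKernel p v d| ≤ C * v ^ ((1 - p) / 2) / d ^ 2 := by
  obtain ⟨C, hC⟩ := sq_mul_weightedD_bounded hp hp1
  refine ⟨C, by simpa using hC 0 le_rfl, fun v d hv hd => ?_⟩
  have h1 := Real.rpow_pos_of_pos hv ((p + 1) / 2)
  have h2 := hC (d / √v) (by positivity)
  rw [div_pow, Real.sq_sqrt hv.le] at h2
  rw [cylinderKernel_eq hv, abs_div, abs_of_pos h1, div_le_div_iff₀ h1 (by positivity)]
  have h3 : v ^ ((1 - p) / 2) * v ^ ((p + 1) / 2) = v := by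
    rw [← Real.rpow_add hv]
    convert Real.rpow_one v using 2
    ring
  rw [mul_assoc, h3]
  calc |weightedD p (d / √v)| * d ^ 2 = d ^ 2 / v * |weightedD p (d / √v)| * v := by
        field_simp
    _ ≤ C * v := by gcongr

section

variable {F : Measure ℝ} [IsFiniteMeasure F] {b : ℝ → ℝ} {p t : ℝ}

/-- The kernel is bounded over all `s < t` and over all levels near a level strictly below the
boundary at `t`. -/
lemma exists_abs_cylinderKernel_boundary_le (hb : ContinuousOn b (Ioi 0)) (ht : 0 < t) (hp : 0 ≤ p)
    (hp1 : p < 1) {y₀ : ℝ} (hy₀ : y₀ < b t) :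
    ∃ r > 0, ∃ M, ∀ s ∈ Ioo 0 t, ∀ y ∈ Metric.ball y₀ r,
      |cylinderKernel p (t - s) (b s - y)| ≤ M := by
  obtain ⟨C₁, hC₁0, hC₁⟩ := exists_abs_cylinderKernel_le hp hp1
  obtain ⟨C₂, hC₂0, hC₂⟩ := exists_abs_cylinderKernel_le_of_pos hp hp1
  set r := (b t - y₀) / 3 with hr
  have hr0 : 0 < r := by linarith
  have hev : ∀ᶠ s in 𝓝 t, b t - r < b s :=
    (hb.continuousAt (Ioi_mem_nhds ht)).eventually_const_lt (by linarith)
  obtain ⟨η, hη, hball⟩ := Metric.eventually_nhds_iff.1 hev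
  refine ⟨r, hr0, max (C₁ * η ^ (-((p + 1) / 2))) (C₂ * t ^ ((1 - p) / 2) / r ^ 2),
    fun s hs y hy => ?_⟩
  have hv : 0 < t - s := sub_pos.2 hs.2
  rw [Metric.mem_ball, Real.dist_eq, abs_lt] at hy
  rcases lt_or_ge (t - s) η with h | h
  · have hbs : b t - r < b s := hball (by rw [Real.dist_eq, abs_sub_comm, abs_of_pos hv]; exact h)
    have hd : r ≤ b s - y := by linarith
    refine (hC₂ _ _ hv (hr0.trans_le hd)).trans (le_max_of_le_right ?_)
    have : t - s ≤ t := by linarith [hs.1]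
    have : 0 ≤ (1 - p) / 2 := by linarith
    gcongr
  · refine (hC₁ _ _ hv).trans (le_max_of_le_left ?_)
    refine mul_le_mul_of_nonneg_left ?_ hC₁0
    exact Real.rpow_le_rpow_of_nonpos hη h (by linarith)

/-- Strictly below the boundary, the equation of order `p - 1` may be differentiated in the level,
which gives the equation of order `p`. -/
lemma levelVolterraEq_of_lt_boundary (hb : ContinuousOn b (Ioi 0)) (ht : 0 < t) (hp : 0 ≤ p)
    (hp1 : p < 1) (h : ∀ y < b t, LevelVolterraEq F b (p - 1) t y) {y₀ : ℝ} (hy₀ : y₀ < b t) :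
    LevelVolterraEq F b p t y₀ := by
  obtain ⟨r, hr, M, hM⟩ := exists_abs_cylinderKernel_boundary_le hb ht hp hp1 hy₀
  obtain ⟨hint, hderiv⟩ := hasDerivAt_integral_of_dominated_loc_of_deriv_le
    (μ := F.restrict (Ioo 0 t)) (F := fun y s => cylinderKernel (p - 1) (t - s) (b s - y))
    (F' := fun y s => cylinderKernel p (t - s) (b s - y)) (x₀ := y₀) (s := Metric.ball y₀ r)
    (bound := fun _ => M) (Metric.ball_mem_nhds y₀ hr)
    (Eventually.of_forall fun y =>
      aestronglyMeasurable_cylinderKernel_boundary (by linarith) hb t y F)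
    (h y₀ hy₀).1 (aestronglyMeasurable_cylinderKernel_boundary hp1 hb t y₀ F)
    ((ae_restrict_mem measurableSet_Ioo).mono fun s hs y hy => hM s hs y hy)
    (integrable_const _)
    ((ae_restrict_mem measurableSet_Ioo).mono fun s hs y _ =>
      hasDerivAt_cylinderKernel hp hp1 (sub_pos.2 hs.2) (b s) y)
  refine ⟨hint, ?_⟩
  have hleft : HasDerivAt (fun y => cylinderKernel (p - 1) t (-y)) (cylinderKernel p t (-y₀)) y₀ := by
    simpa using hasDerivAt_cylinderKernel hp hp1 ht 0 y₀
  refine hleft.unique (hderiv.congr_of_eventuallyEq ?_)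
  filter_upwards [Iio_mem_nhds hy₀] with y hy
  exact (h y hy).2

/-- The equation of order `p` extends from levels below the boundary to the boundary itself, when
the boundary has modulus of continuity `o(√h)` at `t` from the left. Near `t` the kernels are then
nonnegative, so that Fatou's lemma makes the singularity `(t - s)^{-(p+1)/2}` integrable; it
dominates the kernels at all levels below the boundary. -/
lemma levelVolterraEq_boundary (hb : ContinuousOn b (Ioi 0)) (ht : 0 < t) (hp : 0 ≤ p)
    (hp1 : p < 1) (hmod : ∀ δ > 0, ∀ᶠ s in 𝓝[<] t, |b s - b t| ≤ δ * √(t - s))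
    (h : ∀ y < b t, LevelVolterraEq F b p t y) : LevelVolterraEq F b p t (b t) := by
  obtain ⟨C, hC0, hC⟩ := exists_abs_cylinderKernel_le hp hp1
  obtain ⟨δ, c, hδ, hc, hlow, hnonneg⟩ := exists_weightedD_lower_bound hp hp1
  obtain ⟨a, hat, ha⟩ := (mem_nhdsLT_iff_exists_Ioo_subset' (sub_one_lt t)).1 (hmod δ hδ)
  set u := max a (t / 2) with hu
  have hut : u < t := max_lt hat (by linarith)
  have hu0 : 0 < u := lt_max_of_lt_right (by linarith)
  have hnear : ∀ s ∈ Ioo u t, |(b s - b t) / √(t - s)| ≤ δ := by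
    intro s hs
    have hs0 : 0 < √(t - s) := Real.sqrt_pos.2 (sub_pos.2 hs.2)
    rw [abs_div, abs_of_pos hs0, div_le_iff₀ hs0]
    exact ha ⟨(le_max_left _ _).trans_lt hs.1, hs.2⟩
  let y : ℕ → ℝ := fun n => b t - 1 / ((n : ℝ) + 1)
  have hy : ∀ n, y n < b t := fun n => sub_lt_self _ (by positivity)
  have hylim : Tendsto y atTop (𝓝 (b t)) := by
    have := (tendsto_one_div_add_atTop_nhds_zero_nat (𝕜 := ℝ)).const_sub (b t)
    rwa [sub_zero] at this
  let f : ℕ → ℝ → ℝ := fun n s => cylinderKernel p (t - s) (b s - y n)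
  let g : ℝ → ℝ := fun s => cylinderKernel p (t - s) (b s - b t)
  have hcont : ∀ v d : ℝ, 0 < v → ContinuousAt (fun d => cylinderKernel p v d) d := by
    intro v d hv
    have h1 := (continuousOn_cylinderKernel hp1).continuousAt (x := (v, d))
      (prod_mem_nhds (Ioi_mem_nhds hv) univ_mem)
    exact ContinuousAt.comp (f := fun d => (v, d)) h1 (by fun_prop)
  have hflim : ∀ s ∈ Ioo 0 t, Tendsto (fun n => f n s) atTop (𝓝 (g s)) := fun s hs =>
    (hcont (t - s) (b s - b t) (sub_pos.2 hs.2)).tendsto.comp (tendsto_const_nhds.sub hylim)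
  have hfnn : ∀ n, ∀ s ∈ Ioo u t, 0 ≤ f n s := by
    intro n s hs
    have hv : 0 < t - s := sub_pos.2 hs.2
    simp only [f]
    rw [cylinderKernel_eq hv]
    refine div_nonneg (hnonneg _ ?_) (Real.rpow_pos_of_pos hv _).le
    refine (abs_le.1 (hnear s hs)).1.trans ?_
    gcongr
    exact (hy n).le
  -- away from `t` the kernels are bounded
  set M := C * (t - u) ^ (-((p + 1) / 2)) with hM
  have hfar : ∀ s ∈ Ioc 0 u, (t - s) ^ (-((p + 1) / 2)) ≤ (t - u) ^ (-((p + 1) / 2)) := by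
    intro s hs
    exact Real.rpow_le_rpow_of_nonpos (sub_pos.2 hut) (by linarith [hs.2]) (by linarith)
  have hsplit : Ioc 0 u ∪ Ioo u t = Ioo 0 t := Ioc_union_Ioo_eq_Ioo hu0.le hut
  have hdisj : Disjoint (Ioc 0 u) (Ioo u t) :=
    disjoint_left.2 fun s h1 h2 => not_lt.2 h1.2 h2.1
  have hsub1 : Ioc 0 u ⊆ Ioo 0 t := hsplit ▸ subset_union_left
  have hsub2 : Ioo u t ⊆ Ioo 0 t := hsplit ▸ subset_union_right
  have hbound : ∀ n, ∫ s in Ioo u t, f n s ∂F ≤ C * t ^ (-((p + 1) / 2)) + M * F.real (Ioc 0 u) := by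
    intro n
    have h1 := (h (y n) (hy n)).2
    rw [← hsplit, setIntegral_union hdisj measurableSet_Ioo
      ((h (y n) (hy n)).1.mono_set hsub1) ((h (y n) (hy n)).1.mono_set hsub2)] at h1
    have h2 : ‖∫ s in Ioc 0 u, f n s ∂F‖ ≤ M * F.real (Ioc 0 u) := by
      refine norm_setIntegral_le_of_norm_le_const (measure_lt_top _ _) fun s hs => ?_
      exact (hC _ _ (sub_pos.2 (hs.2.trans_lt hut))).trans
        (mul_le_mul_of_nonneg_left (hfar s hs) hC0)
    have h3 := hC t (-y n) ht
    rw [Real.norm_eq_abs] at h2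
    have h4 := (abs_le.1 h2).1
    have h5 := (abs_le.1 h3).2
    simp only [f] at h4 ⊢
    linarith
  have hgint : IntegrableOn g (Ioo u t) F := by
    refine integrable_of_tendsto (G := f)
      ((ae_restrict_mem measurableSet_Ioo).mono fun s hs => hflim s (hsub2 hs))
      (fun n => ((h (y n) (hy n)).1.mono_set hsub2).aestronglyMeasurable) ?_
    refine ne_top_of_le_ne_top (b := ENNReal.ofReal
      (C * t ^ (-((p + 1) / 2)) + M * F.real (Ioc 0 u))) ENNReal.ofReal_ne_top ?_
    refine liminf_le_of_frequently_le' (Frequently.of_forall fun n => ?_)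
    have hnn : 0 ≤ᵐ[F.restrict (Ioo u t)] f n :=
      (ae_restrict_mem measurableSet_Ioo).mono fun s hs => hfnn n s hs
    have hi : Integrable (f n) (F.restrict (Ioo u t)) := (h (y n) (hy n)).1.mono_set hsub2
    have heq : ∫⁻ s in Ioo u t, ‖f n s‖ₑ ∂F = ENNReal.ofReal (∫ s in Ioo u t, f n s ∂F) := by
      rw [ofReal_integral_eq_lintegral_ofReal hi hnn]
      refine lintegral_congr_ae (hnn.mono fun s hs => ?_)
      exact Real.enorm_of_nonneg hs
    rw [heq]
    exact ENNReal.ofReal_le_ofReal (hbound n)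
  have hmeas : AEStronglyMeasurable (fun s => (t - s) ^ (-((p + 1) / 2))) F :=
    ((measurable_const.sub measurable_id).pow_const _).aestronglyMeasurable
  have hsing : IntegrableOn (fun s => (t - s) ^ (-((p + 1) / 2))) (Ioo 0 t) F := by
    rw [← hsplit]
    refine IntegrableOn.union ?_ ?_
    · refine (integrable_const ((t - u) ^ (-((p + 1) / 2)))).mono' hmeas.restrict ?_
      filter_upwards [ae_restrict_mem measurableSet_Ioc] with s hs
      rw [Real.norm_of_nonneg
        (Real.rpow_pos_of_pos (sub_pos.2 (hs.2.trans_lt hut)) _).le]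
      exact hfar s hs
    · refine (hgint.const_mul c⁻¹).mono' hmeas.restrict ?_
      filter_upwards [ae_restrict_mem measurableSet_Ioo] with s hs
      have hv : 0 < t - s := sub_pos.2 hs.2
      have hvp := Real.rpow_pos_of_pos hv ((p + 1) / 2)
      rw [Real.norm_of_nonneg (Real.rpow_pos_of_pos hv _).le, Real.rpow_neg hv.le]
      simp only [g]
      rw [cylinderKernel_eq hv, le_inv_mul_iff₀ hc, ← div_eq_mul_inv]
      gcongr
      exact hlow _ (hnear s hs)
  have hdom : ∀ d, ∀ᵐ s ∂(F.restrict (Ioo 0 t)),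
      ‖cylinderKernel p (t - s) (b s - d)‖ ≤ C * (t - s) ^ (-((p + 1) / 2)) := fun d =>
    (ae_restrict_mem measurableSet_Ioo).mono fun s hs => hC _ _ (sub_pos.2 hs.2)
  have hm := fun d => aestronglyMeasurable_cylinderKernel_boundary hp1 hb t d F
  refine ⟨(hsing.const_mul C).mono' (hm _) (hdom _), ?_⟩
  have hR := tendsto_integral_of_dominated_convergence (F := f) (f := g)
    (fun s => C * (t - s) ^ (-((p + 1) / 2))) (fun n => hm (y n)) (hsing.const_mul C)
    (fun n => hdom (y n)) ((ae_restrict_mem measurableSet_Ioo).mono fun s hs => hflim s hs)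
  have hL : Tendsto (fun n => cylinderKernel p t (-y n)) atTop (𝓝 (cylinderKernel p t (-b t))) :=
    (hcont t (-b t) ht).tendsto.comp hylim.neg
  exact tendsto_nhds_unique hL (hR.congr fun n => (h (y n) (hy n)).2.symm)

end

lemma eventually_abs_sub_le_mul_sqrt {b : ℝ → ℝ} {t : ℝ}
    (hb : DifferentiableAt ℝ b t) {δ : ℝ} (hδ : 0 < δ) :
    ∀ᶠ s in 𝓝[<] t, |b s - b t| ≤ δ * √(t - s) := by
  obtain ⟨C, hC⟩ := hb.isBigO_sub.bound
  have hlim : Tendsto (fun s : ℝ => C * √(t - s)) (𝓝[<] t) (𝓝 0) := by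
    have : Continuous fun s : ℝ => C * √(t - s) := by fun_prop
    exact tendsto_nhdsWithin_of_tendsto_nhds (this.tendsto' t 0 (by simp))
  filter_upwards [nhdsWithin_le_nhds hC, hlim.eventually_le_const hδ, self_mem_nhdsWithin]
    with s hs hs' hst
  have hv : 0 < t - s := sub_pos.2 hst
  rw [Real.norm_eq_abs, Real.norm_eq_abs, abs_sub_comm s, abs_of_pos hv] at hs
  calc |b s - b t| ≤ C * (t - s) := hs
    _ = C * √(t - s) * √(t - s) := by rw [mul_assoc, Real.mul_self_sqrt hv.le]
    _ ≤ δ * √(t - s) := by gcongr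

theorem corollary1 {Ω : Type*} [MeasurableSpace Ω] (P : Measure Ω) [IsProbabilityMeasure P]
    (W : ℝ≥0 → Ω → ℝ) (hW : IsBrownianReal W P)
    (b : ℝ → ℝ) (hb : IsRegularBoundary P W b) :
    (∀ p : ℝ, p ≤ -1 →
      ∀ t : ℝ, 0 < t → BoundaryVolterraEq (firstPassageLaw P W b) b p t) ∧
    (DifferentiableOn ℝ b (Ioi 0) → ∀ p : ℝ, -1 < p → p ≤ 0 →
      ∀ t : ℝ, 0 < t → BoundaryVolterraEq (firstPassageLaw P W b) b p t) ∧
    (ContDiffOn ℝ 1 b (Ioi 0) → ∀ p : ℝ, 0 < p → p < 1 →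
      ∀ t : ℝ, 0 < t → BoundaryVolterraEq (firstPassageLaw P W b) b p t) := by
  have hneg : ∀ {p t y : ℝ}, p < 0 → 0 < t → y ≤ b t →
      LevelVolterraEq (firstPassageLaw P W b) b p t y := fun hp ht hy =>
    levelVolterraEq_of_neg hW hb.continuousOn hb.regular hp ht hy
  have hnonneg : DifferentiableOn ℝ b (Ioi 0) → ∀ {p t : ℝ}, 0 ≤ p → p < 1 → 0 < t →
      LevelVolterraEq (firstPassageLaw P W b) b p t (b t) := fun hd p t hp hp1 ht =>
    levelVolterraEq_boundary hb.continuousOn ht hp hp1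
      (fun δ hδ => eventually_abs_sub_le_mul_sqrt (hd.differentiableAt (Ioi_mem_nhds ht)) hδ)
      fun y hy => levelVolterraEq_of_lt_boundary hb.continuousOn ht hp hp1
        (fun y hy => hneg (by linarith) ht hy.le) hy
  refine ⟨fun p hp t ht => (hneg (by linarith) ht le_rfl).boundary, fun hd p _ hp0 t ht => ?_,
    fun hd p hp hp1 t ht => (hnonneg (hd.differentiableOn one_ne_zero) hp.le hp1 ht).boundary⟩
  rcases hp0.lt_or_eq with hp | rfl
  · exact (hneg hp ht le_rfl).boundary
  · exact (hnonneg hd le_rfl one_pos ht).boundary
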